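/- Let $R$ be a commutative ring and let $C$, $D$ be $R$-coalgebras that are flat as $R$-modules. Write $\mathcal M^C$ (resp. ${}^C\mathcal M$) for the category of right (resp. left) $C$-comodules and $C$-colinear maps, and $M\square_C N=\ker(\varrho_M\otimes \mathrm{id}-\mathrm{id}\otimes\varrho_N: M\otimes N\to M\otimes C\otimes N)$ for the cotensor product of $M\in\mathcal M^C$ and $N\in{}^C\mathcal M$; unadorned tensor products are over $R$. For an $R$-module $W$, $W\otimes M$ is a right comodule via $\mathrm{id}\otimes\varrho_M$. A right $C$-comodule $M$ is called - quasi-finite if the functor $-\otimes M: R\text{-Mod}\to\mathcal M^C$ has a left adjoint $h_C(M,-)$; - an injector if $-\otimes M: R\text{-Mod}\to\mathcal M^C$ maps injective objects to injective objects; - faithfully coflat if $M\square_C-:{}^C\mathcal M\to R\text{-Mod}$ is exact and faithful. For a quasi-finite right $C$-comodule $M$, with unit $\eta:M\to h_C(M,M)\otimes M$, the coendomorphism coalgebra is $e_C(M)=h_C(M,M)$, whose comultiplication and counit are the $R$-linear maps that correspond under the adjunction to $(\mathrm{id}\otimes\eta)\eta:M\to e_C(M)\otimes e_C(M)\otimes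 M$ and to the canonical map $M\to R\otimes M$. For left comodules all these notions are defined symmetrically (with $M\otimes -$, $-\square_C M$, and $\eta:M\to M\otimes h_C(M,M)$). Let $F:\mathcal M^C\to\mathcal M^D$ be an $R$-linear equivalence of categories with inverse $G:\mathcal M^D\to\mathcal M^C$. The canonical maps $\lambda_{W,M}:W\otimes F(M)\to F(W\otimes M)$, $w\otimes x\mapsto F(m\mapsto w\otimes m)(x)$, are isomorphisms, and $F(C)$ is a $C$-$D$-bicomodule with left coaction $\lambda_{C,C}^{-1}\circ F(\Delta_C):F(C)\to C\otimes F(C)$; in the same way $G(D)$ is a $D$-$C$-bicomodule. Then: 1. $F(C)$ is quasi-finite, faithfully coflat and an injector, both as a right $D$-comodule and as a left $C$-comodule; 2. $e_D(F(C))\cong C$ and $e_C(F(C))\cong D$ as coalgebras, where $e_D$ is formed from the right $D$-comodule structure and $e_C$ from the left $C$-comodule structure; 3. $G(D)$ is quasi-finite, faithfully coflat and an injector, both as a right $C$-comodule and as a left $D$-comodule; 4. $e_C(G(D))\cong D$ and $e_D(G(D))\cong C$ as coalgebras, where $e_C$ is formed from the right $C$-comodule structure and $e_D$ from the left $D$-comodule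 structure. -/

import Mathlib

open CategoryTheory
open scoped TensorProduct

universe u

/-! ### Coactions on tensor products with a module -/

namespace Coact

variable {R : Type u} [CommRing R] {C M N V W : Type u}
  [AddCommGroup C] [Module R C] [AddCommGroup M] [Module R M] [AddCommGroup N] [Module R N]
  [AddCommGroup V] [Module R V] [AddCommGroup W] [Module R W]

/-- The map `id ⊗ ϱ : W ⊗ M → W ⊗ M ⊗ C` for `ϱ : M → M ⊗ C`. -/
def right (W : Type u) [AddCommGroup W] [Module R W] (ρ : M →ₗ[R] M ⊗[R] C) :
    W ⊗[R] M →ₗ[R] (W ⊗[R] M) ⊗[R] C :=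
  (TensorProduct.assoc R W M C).symm.toLinearMap ∘ₗ ρ.lTensor W

/-- The map `ϱ ⊗ id : M ⊗ W → C ⊗ M ⊗ W` for `ϱ : M → C ⊗ M`. -/
def left (ρ : M →ₗ[R] C ⊗[R] M) (W : Type u) [AddCommGroup W] [Module R W] :
    M ⊗[R] W →ₗ[R] C ⊗[R] (M ⊗[R] W) :=
  (TensorProduct.assoc R C M W).toLinearMap ∘ₗ ρ.rTensor W

@[simp] theorem right_tmul (ρ : M →ₗ[R] M ⊗[R] C) (w : W) (m : M) :
    right W ρ (w ⊗ₜ m) = (TensorProduct.assoc R W M C).symm (w ⊗ₜ ρ m) := rfl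

@[simp] theorem left_tmul (ρ : M →ₗ[R] C ⊗[R] M) (w : W) (m : M) :
    left ρ W (m ⊗ₜ w) = TensorProduct.assoc R C M W (ρ m ⊗ₜ w) := rfl

theorem right_coassoc (Δ : C →ₗ[R] C ⊗[R] C) (ρ : M →ₗ[R] M ⊗[R] C)
    (h : (TensorProduct.assoc R M C C).toLinearMap ∘ₗ ρ.rTensor C ∘ₗ ρ = Δ.lTensor M ∘ₗ ρ) :
    (TensorProduct.assoc R (W ⊗[R] M) C C).toLinearMap ∘ₗ (right W ρ).rTensor C ∘ₗ right W ρ =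
      Δ.lTensor (W ⊗[R] M) ∘ₗ right W ρ := by
  refine TensorProduct.ext' fun w m => ?_
  replace h := LinearMap.congr_fun h m
  simp only [LinearMap.comp_apply, LinearEquiv.coe_coe, right_tmul] at h ⊢
  have h1 : ∀ y : M ⊗[R] C, TensorProduct.assoc R (W ⊗[R] M) C C
      ((right W ρ).rTensor C ((TensorProduct.assoc R W M C).symm (w ⊗ₜ y))) =
      (TensorProduct.assoc R W M (C ⊗[R] C)).symm
        (w ⊗ₜ (TensorProduct.assoc R M C C (ρ.rTensor C y))) := by
    intro y
    induction y with
    | zero => simp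
    | add a b ha hb => simp only [TensorProduct.tmul_add, map_add, ha, hb]
    | tmul a c =>
      simp only [TensorProduct.assoc_symm_tmul, LinearMap.rTensor_tmul, right_tmul]
      generalize ρ a = z
      induction z <;> simp_all [TensorProduct.tmul_add, TensorProduct.add_tmul]
  have h2 : ∀ y : M ⊗[R] C,
      Δ.lTensor (W ⊗[R] M) ((TensorProduct.assoc R W M C).symm (w ⊗ₜ y)) =
      (TensorProduct.assoc R W M (C ⊗[R] C)).symm (w ⊗ₜ (Δ.lTensor M y)) := by
    intro y
    induction y <;> simp_all [TensorProduct.tmul_add]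
  rw [h1, h2, h]

theorem right_counit (ε : C →ₗ[R] R) (ρ : M →ₗ[R] M ⊗[R] C)
    (h : ε.lTensor M ∘ₗ ρ = (TensorProduct.mk R M R).flip 1) :
    ε.lTensor (W ⊗[R] M) ∘ₗ right W ρ = (TensorProduct.mk R (W ⊗[R] M) R).flip 1 := by
  refine TensorProduct.ext' fun w m => ?_
  replace h := LinearMap.congr_fun h m
  simp only [LinearMap.comp_apply, right_tmul, LinearMap.flip_apply,
    TensorProduct.mk_apply] at h ⊢
  have h2 : ∀ y : M ⊗[R] C,
      ε.lTensor (W ⊗[R] M) ((TensorProduct.assoc R W M C).symm (w ⊗ₜ y)) =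
      (TensorProduct.assoc R W M R).symm (w ⊗ₜ (ε.lTensor M y)) := by
    intro y
    induction y <;> simp_all [TensorProduct.tmul_add]
  rw [h2, h, TensorProduct.assoc_symm_tmul]

theorem right_mapLeft (g : V →ₗ[R] W) (ρ : M →ₗ[R] M ⊗[R] C) :
    right W ρ ∘ₗ g.rTensor M = (g.rTensor M).rTensor C ∘ₗ right V ρ := by
  refine TensorProduct.ext' fun v m => ?_
  simp only [LinearMap.comp_apply, LinearMap.rTensor_tmul, right_tmul]
  generalize ρ m = z
  induction z <;> simp_all [TensorProduct.tmul_add]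

theorem right_mapRight (f : M →ₗ[R] N) (ρ : M →ₗ[R] M ⊗[R] C) (σ : N →ₗ[R] N ⊗[R] C)
    (h : σ ∘ₗ f = f.rTensor C ∘ₗ ρ) :
    right W σ ∘ₗ f.lTensor W = (f.lTensor W).rTensor C ∘ₗ right W ρ := by
  refine TensorProduct.ext' fun v m => ?_
  replace h := LinearMap.congr_fun h m
  simp only [LinearMap.comp_apply, LinearMap.lTensor_tmul, right_tmul] at h ⊢
  rw [h]
  generalize ρ m = z
  induction z <;> simp_all [TensorProduct.tmul_add]

theorem right_assoc (ρ : M →ₗ[R] M ⊗[R] C) :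
    right (V ⊗[R] W) ρ ∘ₗ (TensorProduct.assoc R V W M).symm.toLinearMap =
      (TensorProduct.assoc R V W M).symm.toLinearMap.rTensor C ∘ₗ right V (right W ρ) := by
  refine TensorProduct.ext' fun v y => ?_
  induction y with
  | zero => simp
  | add a b ha hb => simp only [TensorProduct.tmul_add, map_add, ha, hb]
  | tmul w m =>
    simp only [LinearMap.comp_apply, LinearEquiv.coe_coe, TensorProduct.assoc_symm_tmul,
      right_tmul]
    generalize ρ m = z
    induction z <;> simp_all [TensorProduct.tmul_add]

theorem right_insert (ρ : M →ₗ[R] M ⊗[R] C) (w : W) :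
    right W ρ ∘ₗ TensorProduct.mk R W M w = (TensorProduct.mk R W M w).rTensor C ∘ₗ ρ := by
  ext m
  simp only [LinearMap.comp_apply, TensorProduct.mk_apply, right_tmul]
  generalize ρ m = z
  induction z <;> simp_all [TensorProduct.tmul_add]

theorem left_coassoc (Δ : C →ₗ[R] C ⊗[R] C) (ρ : M →ₗ[R] C ⊗[R] M)
    (h : (TensorProduct.assoc R C C M).toLinearMap ∘ₗ Δ.rTensor M ∘ₗ ρ = ρ.lTensor C ∘ₗ ρ) :
    (TensorProduct.assoc R C C (M ⊗[R] W)).toLinearMap ∘ₗ Δ.rTensor (M ⊗[R] W) ∘ₗ left ρ W =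
      (left ρ W).lTensor C ∘ₗ left ρ W := by
  refine TensorProduct.ext' fun m w => ?_
  replace h := LinearMap.congr_fun h m
  simp only [LinearMap.comp_apply, LinearEquiv.coe_coe, left_tmul] at h ⊢
  have h1 : ∀ y : C ⊗[R] M,
      (left ρ W).lTensor C (TensorProduct.assoc R C M W (y ⊗ₜ w)) =
      (TensorProduct.assoc R C M W).toLinearMap.lTensor C
        (TensorProduct.assoc R C (C ⊗[R] M) W (ρ.lTensor C y ⊗ₜ w)) := by
    intro y
    induction y <;> simp_all [TensorProduct.add_tmul]
  have h2 : ∀ y : C ⊗[R] M, TensorProduct.assoc R C C (M ⊗[R] W)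
      (Δ.rTensor (M ⊗[R] W) (TensorProduct.assoc R C M W (y ⊗ₜ w))) =
      (TensorProduct.assoc R C M W).toLinearMap.lTensor C
        (TensorProduct.assoc R C (C ⊗[R] M) W
          (TensorProduct.assoc R C C M (Δ.rTensor M y) ⊗ₜ w)) := by
    intro y
    induction y with
    | zero => simp
    | add a b ha hb => simp only [TensorProduct.add_tmul, map_add, ha, hb]
    | tmul a c =>
      simp only [TensorProduct.assoc_tmul, LinearMap.rTensor_tmul]
      generalize Δ a = z
      induction z <;> simp_all [TensorProduct.add_tmul]
  rw [h1, h2, h]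

theorem left_counit (ε : C →ₗ[R] R) (ρ : M →ₗ[R] C ⊗[R] M)
    (h : ε.rTensor M ∘ₗ ρ = TensorProduct.mk R R M 1) :
    ε.rTensor (M ⊗[R] W) ∘ₗ left ρ W = TensorProduct.mk R R (M ⊗[R] W) 1 := by
  refine TensorProduct.ext' fun m w => ?_
  replace h := LinearMap.congr_fun h m
  simp only [LinearMap.comp_apply, left_tmul, TensorProduct.mk_apply] at h ⊢
  have h2 : ∀ y : C ⊗[R] M,
      ε.rTensor (M ⊗[R] W) (TensorProduct.assoc R C M W (y ⊗ₜ w)) =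
      TensorProduct.assoc R R M W (ε.rTensor M y ⊗ₜ w) := by
    intro y
    induction y <;> simp_all [TensorProduct.add_tmul]
  rw [h2, h, TensorProduct.assoc_tmul]

theorem left_mapRight (g : V →ₗ[R] W) (ρ : M →ₗ[R] C ⊗[R] M) :
    left ρ W ∘ₗ g.lTensor M = (g.lTensor M).lTensor C ∘ₗ left ρ V := by
  refine TensorProduct.ext' fun m v => ?_
  simp only [LinearMap.comp_apply, LinearMap.lTensor_tmul, left_tmul]
  generalize ρ m = z
  induction z <;> simp_all [TensorProduct.add_tmul]

theorem left_mapLeft (f : M →ₗ[R] N) (ρ : M →ₗ[R] C ⊗[R] M) (σ : N →ₗ[R] C ⊗[R] N)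
    (h : σ ∘ₗ f = f.lTensor C ∘ₗ ρ) :
    left σ W ∘ₗ f.rTensor W = (f.rTensor W).lTensor C ∘ₗ left ρ W := by
  refine TensorProduct.ext' fun m v => ?_
  replace h := LinearMap.congr_fun h m
  simp only [LinearMap.comp_apply, LinearMap.rTensor_tmul, left_tmul] at h ⊢
  rw [h]
  generalize ρ m = z
  induction z <;> simp_all [TensorProduct.add_tmul]

theorem left_assoc (ρ : M →ₗ[R] C ⊗[R] M) :
    left ρ (V ⊗[R] W) ∘ₗ (TensorProduct.assoc R M V W).toLinearMap =
      (TensorProduct.assoc R M V W).toLinearMap.lTensor C ∘ₗ left (left ρ V) W := by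
  refine TensorProduct.ext_threefold fun m v w => ?_
  simp only [LinearMap.comp_apply, LinearEquiv.coe_coe, TensorProduct.assoc_tmul, left_tmul]
  generalize ρ m = z
  induction z <;> simp_all [TensorProduct.add_tmul]

theorem left_insert (ρ : M →ₗ[R] C ⊗[R] M) (w : W) :
    left ρ W ∘ₗ (TensorProduct.mk R M W).flip w =
      ((TensorProduct.mk R M W).flip w).lTensor C ∘ₗ ρ := by
  ext m
  simp only [LinearMap.comp_apply, LinearMap.flip_apply, TensorProduct.mk_apply, left_tmul]
  generalize ρ m = z
  induction z <;> simp_all [TensorProduct.add_tmul]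

/-! Coassociativity and counitality of the maps induced by a universal map `η : M → V ⊗ M`
(respectively `η : M → M ⊗ V`). -/

theorem coend_right_coassoc (η : M →ₗ[R] V ⊗[R] M) (Δ : V →ₗ[R] V ⊗[R] V)
    (hη : ∀ f g : V →ₗ[R] V ⊗[R] (V ⊗[R] V), f.rTensor M ∘ₗ η = g.rTensor M ∘ₗ η → f = g)
    (hΔ : Δ.rTensor M ∘ₗ η =
      (TensorProduct.assoc R V V M).symm.toLinearMap ∘ₗ η.lTensor V ∘ₗ η) :
    (TensorProduct.assoc R V V V).toLinearMap ∘ₗ Δ.rTensor V ∘ₗ Δ = Δ.lTensor V ∘ₗ Δ := by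
  have hΔ' : ∀ x, Δ.rTensor M (η x) = (TensorProduct.assoc R V V M).symm (η.lTensor V (η x)) :=
    fun x => LinearMap.congr_fun hΔ x
  apply hη
  ext x
  simp only [LinearMap.rTensor_comp, LinearMap.comp_apply, hΔ']
  have h1 : ∀ z : V ⊗[R] M, (TensorProduct.assoc R V V V).toLinearMap.rTensor M
      ((Δ.rTensor V).rTensor M ((TensorProduct.assoc R V V M).symm (η.lTensor V z))) =
      (TensorProduct.assoc R V V V).toLinearMap.rTensor M
        ((TensorProduct.assoc R (V ⊗[R] V) V M).symm (η.lTensor (V ⊗[R] V) (Δ.rTensor M z))) := by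
    intro z
    induction z with
    | zero => simp
    | add a b ha hb => simp only [map_add, ha, hb]
    | tmul v m =>
      simp only [LinearMap.lTensor_tmul, LinearMap.rTensor_tmul]
      generalize η m = y
      induction y <;> simp_all [TensorProduct.tmul_add]
  have h2 : ∀ z : V ⊗[R] M, (Δ.lTensor V).rTensor M
      ((TensorProduct.assoc R V V M).symm (η.lTensor V z)) =
      (TensorProduct.assoc R V (V ⊗[R] V) M).symm
        ((Δ.rTensor M ∘ₗ η).lTensor V z) := by
    intro z
    induction z with
    | zero => simp
    | add a b ha hb => simp only [map_add, ha, hb]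
    | tmul v m =>
      simp only [LinearMap.lTensor_tmul, LinearMap.comp_apply]
      generalize η m = y
      induction y <;> simp_all [TensorProduct.tmul_add]
  rw [h1, h2, hΔ', hΔ]
  generalize η x = z
  induction z with
  | zero => simp
  | add a b ha hb => simp only [map_add, ha, hb]
  | tmul v m =>
    simp only [LinearMap.lTensor_tmul, LinearMap.comp_apply]
    generalize η m = y
    induction y with
    | zero => simp
    | add a b ha hb => simp only [TensorProduct.tmul_add, map_add, ha, hb]
    | tmul a c =>
      simp only [LinearMap.lTensor_tmul, TensorProduct.assoc_symm_tmul, LinearEquiv.coe_coe]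
      generalize η c = y
      induction y <;> simp_all [TensorProduct.tmul_add]

theorem coend_right_rTensor_counit (η : M →ₗ[R] V ⊗[R] M) (Δ : V →ₗ[R] V ⊗[R] V)
    (ε : V →ₗ[R] R)
    (hη : ∀ f g : V →ₗ[R] R ⊗[R] V, f.rTensor M ∘ₗ η = g.rTensor M ∘ₗ η → f = g)
    (hΔ : Δ.rTensor M ∘ₗ η =
      (TensorProduct.assoc R V V M).symm.toLinearMap ∘ₗ η.lTensor V ∘ₗ η)
    (hε : ε.rTensor M ∘ₗ η = TensorProduct.mk R R M 1) :
    ε.rTensor V ∘ₗ Δ = TensorProduct.mk R R V 1 := by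
  have hΔ' : ∀ x, Δ.rTensor M (η x) = (TensorProduct.assoc R V V M).symm (η.lTensor V (η x)) :=
    fun x => LinearMap.congr_fun hΔ x
  have hε' : ∀ x, ε.rTensor M (η x) = 1 ⊗ₜ x := fun x => LinearMap.congr_fun hε x
  apply hη
  ext x
  simp only [LinearMap.rTensor_comp, LinearMap.comp_apply, hΔ']
  have h1 : ∀ z : V ⊗[R] M,
      (ε.rTensor V).rTensor M ((TensorProduct.assoc R V V M).symm (η.lTensor V z)) =
      (TensorProduct.assoc R R V M).symm (η.lTensor R (ε.rTensor M z)) := by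
    intro z
    induction z with
    | zero => simp
    | add a b ha hb => simp only [map_add, ha, hb]
    | tmul v m =>
      simp only [LinearMap.lTensor_tmul, LinearMap.rTensor_tmul]
      generalize η m = y
      induction y <;> simp_all [TensorProduct.tmul_add]
  rw [h1, hε', LinearMap.lTensor_tmul]
  generalize η x = y
  induction y <;> simp_all [TensorProduct.tmul_add]

theorem coend_right_lTensor_counit (η : M →ₗ[R] V ⊗[R] M) (Δ : V →ₗ[R] V ⊗[R] V)
    (ε : V →ₗ[R] R)
    (hη : ∀ f g : V →ₗ[R] V ⊗[R] R, f.rTensor M ∘ₗ η = g.rTensor M ∘ₗ η → f = g)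
    (hΔ : Δ.rTensor M ∘ₗ η =
      (TensorProduct.assoc R V V M).symm.toLinearMap ∘ₗ η.lTensor V ∘ₗ η)
    (hε : ε.rTensor M ∘ₗ η = TensorProduct.mk R R M 1) :
    ε.lTensor V ∘ₗ Δ = (TensorProduct.mk R V R).flip 1 := by
  have hΔ' : ∀ x, Δ.rTensor M (η x) = (TensorProduct.assoc R V V M).symm (η.lTensor V (η x)) :=
    fun x => LinearMap.congr_fun hΔ x
  apply hη
  ext x
  simp only [LinearMap.rTensor_comp, LinearMap.comp_apply, hΔ']
  have h1 : ∀ z : V ⊗[R] M,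
      (ε.lTensor V).rTensor M ((TensorProduct.assoc R V V M).symm (η.lTensor V z)) =
      (TensorProduct.assoc R V R M).symm ((ε.rTensor M ∘ₗ η).lTensor V z) := by
    intro z
    induction z with
    | zero => simp
    | add a b ha hb => simp only [map_add, ha, hb]
    | tmul v m =>
      simp only [LinearMap.lTensor_tmul, LinearMap.comp_apply]
      generalize η m = y
      induction y <;> simp_all [TensorProduct.tmul_add]
  rw [h1, hε]
  generalize η x = y
  induction y <;> simp_all

theorem coend_left_coassoc (η : M →ₗ[R] M ⊗[R] V) (Δ : V →ₗ[R] V ⊗[R] V)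
    (hη : ∀ f g : V →ₗ[R] V ⊗[R] (V ⊗[R] V), f.lTensor M ∘ₗ η = g.lTensor M ∘ₗ η → f = g)
    (hΔ : Δ.lTensor M ∘ₗ η =
      (TensorProduct.assoc R M V V).toLinearMap ∘ₗ η.rTensor V ∘ₗ η) :
    (TensorProduct.assoc R V V V).toLinearMap ∘ₗ Δ.rTensor V ∘ₗ Δ = Δ.lTensor V ∘ₗ Δ := by
  have hΔ' : ∀ x, Δ.lTensor M (η x) = TensorProduct.assoc R M V V (η.rTensor V (η x)) :=
    fun x => LinearMap.congr_fun hΔ x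
  apply hη
  ext x
  simp only [LinearMap.lTensor_comp, LinearMap.comp_apply, hΔ']
  have h1 : ∀ z : M ⊗[R] V, (Δ.lTensor V).lTensor M
      (TensorProduct.assoc R M V V (η.rTensor V z)) =
      TensorProduct.assoc R M V (V ⊗[R] V) (η.rTensor (V ⊗[R] V) (Δ.lTensor M z)) := by
    intro z
    induction z with
    | zero => simp
    | add a b ha hb => simp only [map_add, ha, hb]
    | tmul m v =>
      simp only [LinearMap.lTensor_tmul, LinearMap.rTensor_tmul]
      generalize η m = y
      induction y <;> simp_all [TensorProduct.add_tmul]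
  have h2 : ∀ z : M ⊗[R] V, (TensorProduct.assoc R V V V).toLinearMap.lTensor M
      ((Δ.rTensor V).lTensor M (TensorProduct.assoc R M V V (η.rTensor V z))) =
      (TensorProduct.assoc R V V V).toLinearMap.lTensor M
        (TensorProduct.assoc R M (V ⊗[R] V) V ((Δ.lTensor M ∘ₗ η).rTensor V z)) := by
    intro z
    induction z with
    | zero => simp
    | add a b ha hb => simp only [map_add, ha, hb]
    | tmul m v =>
      simp only [LinearMap.rTensor_tmul, LinearMap.comp_apply]
      generalize η m = y
      induction y <;> simp_all [TensorProduct.add_tmul]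
  rw [h1, h2, hΔ', hΔ]
  generalize η x = z
  induction z with
  | zero => simp
  | add a b ha hb => simp only [map_add, ha, hb]
  | tmul m v =>
    simp only [LinearMap.rTensor_tmul, LinearMap.comp_apply]
    generalize η m = y
    induction y with
    | zero => simp
    | add a b ha hb => simp only [TensorProduct.add_tmul, map_add, ha, hb]
    | tmul a c =>
      simp only [LinearMap.rTensor_tmul, TensorProduct.assoc_tmul, LinearEquiv.coe_coe]
      generalize η a = y
      induction y <;> simp_all [TensorProduct.add_tmul]

theorem coend_left_lTensor_counit (η : M →ₗ[R] M ⊗[R] V) (Δ : V →ₗ[R] V ⊗[R] V)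
    (ε : V →ₗ[R] R)
    (hη : ∀ f g : V →ₗ[R] V ⊗[R] R, f.lTensor M ∘ₗ η = g.lTensor M ∘ₗ η → f = g)
    (hΔ : Δ.lTensor M ∘ₗ η =
      (TensorProduct.assoc R M V V).toLinearMap ∘ₗ η.rTensor V ∘ₗ η)
    (hε : ε.lTensor M ∘ₗ η = (TensorProduct.mk R M R).flip 1) :
    ε.lTensor V ∘ₗ Δ = (TensorProduct.mk R V R).flip 1 := by
  have hΔ' : ∀ x, Δ.lTensor M (η x) = TensorProduct.assoc R M V V (η.rTensor V (η x)) :=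
    fun x => LinearMap.congr_fun hΔ x
  have hε' : ∀ x, ε.lTensor M (η x) = x ⊗ₜ 1 := fun x => LinearMap.congr_fun hε x
  apply hη
  ext x
  simp only [LinearMap.lTensor_comp, LinearMap.comp_apply, hΔ']
  have h1 : ∀ z : M ⊗[R] V,
      (ε.lTensor V).lTensor M (TensorProduct.assoc R M V V (η.rTensor V z)) =
      TensorProduct.assoc R M V R (η.rTensor R (ε.lTensor M z)) := by
    intro z
    induction z with
    | zero => simp
    | add a b ha hb => simp only [map_add, ha, hb]
    | tmul m v =>
      simp only [LinearMap.lTensor_tmul, LinearMap.rTensor_tmul]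
      generalize η m = y
      induction y <;> simp_all [TensorProduct.add_tmul]
  rw [h1, hε', LinearMap.rTensor_tmul]
  generalize η x = y
  induction y <;> simp_all [TensorProduct.add_tmul]

theorem coend_left_rTensor_counit (η : M →ₗ[R] M ⊗[R] V) (Δ : V →ₗ[R] V ⊗[R] V)
    (ε : V →ₗ[R] R)
    (hη : ∀ f g : V →ₗ[R] R ⊗[R] V, f.lTensor M ∘ₗ η = g.lTensor M ∘ₗ η → f = g)
    (hΔ : Δ.lTensor M ∘ₗ η =
      (TensorProduct.assoc R M V V).toLinearMap ∘ₗ η.rTensor V ∘ₗ η)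
    (hε : ε.lTensor M ∘ₗ η = (TensorProduct.mk R M R).flip 1) :
    ε.rTensor V ∘ₗ Δ = TensorProduct.mk R R V 1 := by
  have hΔ' : ∀ x, Δ.lTensor M (η x) = TensorProduct.assoc R M V V (η.rTensor V (η x)) :=
    fun x => LinearMap.congr_fun hΔ x
  apply hη
  ext x
  simp only [LinearMap.lTensor_comp, LinearMap.comp_apply, hΔ']
  have h1 : ∀ z : M ⊗[R] V,
      (ε.rTensor V).lTensor M (TensorProduct.assoc R M V V (η.rTensor V z)) =
      TensorProduct.assoc R M R V ((ε.lTensor M ∘ₗ η).rTensor V z) := by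
    intro z
    induction z with
    | zero => simp
    | add a b ha hb => simp only [map_add, ha, hb]
    | tmul m v =>
      simp only [LinearMap.rTensor_tmul, LinearMap.comp_apply]
      generalize η m = y
      induction y <;> simp_all [TensorProduct.add_tmul]
  rw [h1, hε]
  generalize η x = y
  induction y <;> simp_all

end Coact

/-! ### Right comodules -/

/-- A right comodule over an `R`-coalgebra `C`. -/
structure RightComod (R : Type u) [CommRing R] (C : Type u) [AddCommGroup C] [Module R C]
    [Coalgebra R C] where
  carrier : Type u
  [addCommGroup : AddCommGroup carrier]
  [module : Module R carrier]
  coact : carrier →ₗ[R] carrier ⊗[R] C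
  coassoc : (TensorProduct.assoc R carrier C C).toLinearMap ∘ₗ coact.rTensor C ∘ₗ coact =
    (Coalgebra.comul (R := R) (A := C)).lTensor carrier ∘ₗ coact
  counit_coact : (Coalgebra.counit (R := R) (A := C)).lTensor carrier ∘ₗ coact =
    (TensorProduct.mk R carrier R).flip 1

attribute [instance] RightComod.addCommGroup RightComod.module

namespace RightComod

section Basic

variable {R : Type u} [CommRing R] {C : Type u} [AddCommGroup C] [Module R C] [Coalgebra R C]

/-- `C`-colinear maps. -/
@[ext]
structure Hom (M N : RightComod R C) where
  lin : M.carrier →ₗ[R] N.carrier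
  colinear : N.coact ∘ₗ lin = lin.rTensor C ∘ₗ M.coact

/-- The category of right `C`-comodules and `C`-colinear maps. -/
instance category : Category (RightComod R C) where
  Hom M N := Hom M N
  id M := ⟨LinearMap.id, by simp⟩
  comp {L M N} f g := ⟨g.lin ∘ₗ f.lin, by
    rw [← LinearMap.comp_assoc, g.colinear, LinearMap.comp_assoc, f.colinear,
      LinearMap.rTensor_comp, LinearMap.comp_assoc]⟩

@[ext]
theorem hom_ext {M N : RightComod R C} {f g : M ⟶ N} (h : f.lin = g.lin) : f = g :=
  Hom.ext h

@[simp] theorem id_lin (M : RightComod R C) : Hom.lin (𝟙 M) = LinearMap.id := rfl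

@[simp] theorem comp_lin {L M N : RightComod R C} (f : L ⟶ M) (g : M ⟶ N) :
    (f ≫ g).lin = g.lin ∘ₗ f.lin := rfl

/-- Colinear maps are added and scaled as linear maps. -/
instance homZero (M N : RightComod R C) : Zero (M ⟶ N) := ⟨⟨0, by simp⟩⟩

instance homAdd (M N : RightComod R C) : Add (M ⟶ N) := ⟨fun f g => ⟨f.lin + g.lin, by
  rw [LinearMap.comp_add, f.colinear, g.colinear, LinearMap.rTensor_add, LinearMap.add_comp]⟩⟩

instance homNeg (M N : RightComod R C) : Neg (M ⟶ N) := ⟨fun f => ⟨-f.lin, by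
  rw [LinearMap.comp_neg, f.colinear, LinearMap.rTensor_neg, LinearMap.neg_comp]⟩⟩

instance homAddCommGroup (M N : RightComod R C) : AddCommGroup (M ⟶ N) where
  add_assoc f g h := hom_ext (add_assoc f.lin g.lin h.lin)
  zero_add f := hom_ext (zero_add f.lin)
  add_zero f := hom_ext (add_zero f.lin)
  add_comm f g := hom_ext (add_comm f.lin g.lin)
  neg_add_cancel f := hom_ext (neg_add_cancel f.lin)
  nsmul := nsmulRec
  zsmul := zsmulRec

@[simp] theorem add_lin {M N : RightComod R C} (f g : M ⟶ N) : (f + g).lin = f.lin + g.lin := rfl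

instance homModule (M N : RightComod R C) : Module R (M ⟶ N) where
  smul r f := ⟨r • f.lin, by
    rw [LinearMap.comp_smul, f.colinear, LinearMap.rTensor_smul, LinearMap.smul_comp]⟩
  one_smul f := hom_ext (one_smul R f.lin)
  mul_smul r s f := hom_ext (mul_smul r s f.lin)
  smul_zero r := hom_ext (smul_zero r)
  smul_add r f g := hom_ext (smul_add r f.lin g.lin)
  add_smul r s f := hom_ext (add_smul r s f.lin)
  zero_smul f := hom_ext (zero_smul R f.lin)

@[simp] theorem smul_lin {M N : RightComod R C} (r : R) (f : M ⟶ N) :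
    (r • f).lin = r • f.lin := rfl

instance : Preadditive (RightComod R C) where
  add_comp _ _ _ f g h := by ext x; simp
  comp_add _ _ _ f g h := by ext x; simp

instance : Linear R (RightComod R C) where
  smul_comp _ _ _ r f g := by ext x; simp
  comp_smul _ _ _ f r g := by ext x; simp

variable {V W : Type u} [AddCommGroup V] [Module R V] [AddCommGroup W] [Module R W]

/-- `C` as a right comodule over itself. -/
def regular (R : Type u) [CommRing R] (C : Type u) [AddCommGroup C] [Module R C]
    [Coalgebra R C] : RightComod R C where
  carrier := C
  coact := Coalgebra.comul
  coassoc := Coalgebra.coassoc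
  counit_coact := Coalgebra.lTensor_counit_comp_comul

/-- `W ⊗ M` with the coaction `id ⊗ ϱ_M`, for an `R`-module `W`. -/
abbrev tensor (W : Type u) [AddCommGroup W] [Module R W] (M : RightComod R C) :
    RightComod R C where
  carrier := W ⊗[R] M.carrier
  coact := Coact.right W M.coact
  coassoc := Coact.right_coassoc _ _ M.coassoc
  counit_coact := Coact.right_counit _ _ M.counit_coact

/-- `g ⊗ id : V ⊗ M ⟶ W ⊗ M` for an `R`-linear map `g : V → W`. -/
def tensorMapLeft
    (g : V →ₗ[R] W) (M : RightComod R C) : tensor V M ⟶ tensor W M where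
  lin := g.rTensor M.carrier
  colinear := Coact.right_mapLeft g M.coact

/-- `id ⊗ f : W ⊗ M ⟶ W ⊗ N` for a colinear map `f : M ⟶ N`. -/
def tensorMapRight (W : Type u) [AddCommGroup W] [Module R W] {M N : RightComod R C}
    (f : M ⟶ N) : tensor W M ⟶ tensor W N where
  lin := f.lin.lTensor W
  colinear := Coact.right_mapRight f.lin M.coact N.coact f.colinear

/-- The colinear isomorphism `V ⊗ (W ⊗ M) ⟶ (V ⊗ W) ⊗ M`. -/
def tensorAssocInv (V W : Type u) [AddCommGroup V] [Module R V] [AddCommGroup W] [Module R W]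
    (M : RightComod R C) : tensor V (tensor W M) ⟶ tensor (V ⊗[R] W) M where
  lin := (TensorProduct.assoc R V W M.carrier).symm.toLinearMap
  colinear := Coact.right_assoc M.coact

/-- For `w ∈ W` the colinear map `M ⟶ W ⊗ M`, `m ↦ w ⊗ m`. -/
def insert (w : W) (M : RightComod R C) :
    M ⟶ tensor W M where
  lin := TensorProduct.mk R W M.carrier w
  colinear := Coact.right_insert M.coact w

/-- The functor `- ⊗ M` from `R`-modules to right `C`-comodules. -/
def tensorFunctor (M : RightComod R C) : ModuleCat.{u} R ⥤ RightComod R C where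
  obj W := tensor W M
  map g := tensorMapLeft g.hom M
  map_id _ := hom_ext (LinearMap.rTensor_id _ _)
  map_comp f g := hom_ext (LinearMap.rTensor_comp _ g.hom f.hom)

/-- `M` is quasi-finite: the functor `- ⊗ M` has a left adjoint (the cohom functor). -/
abbrev QuasiFinite (M : RightComod R C) : Prop := M.tensorFunctor.IsRightAdjoint

/-- `M` is an injector: the functor `- ⊗ M` respects injective objects. -/
def Injector (M : RightComod R C) : Prop :=
  ∀ W : ModuleCat.{u} R, Injective W → Injective (M.tensorFunctor.obj W)

/-- The cohom functor of a quasi-finite comodule `X`. -/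
noncomputable def cohom (X : RightComod R C) [QuasiFinite X] : RightComod R C ⥤ ModuleCat.{u} R :=
  X.tensorFunctor.leftAdjoint

/-- The adjunction between the cohom functor and `- ⊗ X`. -/
noncomputable def cohomAdj (X : RightComod R C) [QuasiFinite X] : X.cohom ⊣ X.tensorFunctor :=
  Adjunction.ofIsRightAdjoint X.tensorFunctor

/-- The `R`-linear map `h(X, M) → W` corresponding to a colinear map `M ⟶ W ⊗ X`. -/
noncomputable def cohomDesc (X : RightComod R C) [QuasiFinite X] {M : RightComod R C} (f : M ⟶ tensor W X) : X.cohom.obj M →ₗ[R] W :=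
  ((X.cohomAdj.homEquiv M (ModuleCat.of R W)).symm f).hom

/-- The underlying module `h(X, X)` of the coendomorphism coalgebra of `X`. -/
def Coend (X : RightComod R C) [QuasiFinite X] : Type u := X.cohom.obj X

noncomputable instance (X : RightComod R C) [QuasiFinite X] : AddCommGroup X.Coend :=
  inferInstanceAs (AddCommGroup (X.cohom.obj X))

noncomputable instance (X : RightComod R C) [QuasiFinite X] : Module R X.Coend :=
  inferInstanceAs (Module R (X.cohom.obj X))

/-- The unit `X ⟶ h(X, X) ⊗ X` of the cohom adjunction. -/
noncomputable def coendUnit (X : RightComod R C) [QuasiFinite X] : X ⟶ tensor X.Coend X :=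
  X.cohomAdj.unit.app X

/-- The comultiplication of `h(X, X)` corresponds to `(id ⊗ η) η : X ⟶ h(X, X) ⊗ h(X, X) ⊗ X`. -/
noncomputable def coendComul (X : RightComod R C) [QuasiFinite X] :
    X.Coend →ₗ[R] X.Coend ⊗[R] X.Coend :=
  X.cohomDesc (X.coendUnit ≫ tensorMapRight X.Coend X.coendUnit ≫
    tensorAssocInv X.Coend X.Coend X)

/-- The counit of `h(X, X)` corresponds to the canonical map `X ⟶ R ⊗ X`. -/
noncomputable def coendCounit (X : RightComod R C) [QuasiFinite X] : X.Coend →ₗ[R] R :=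
  X.cohomDesc (insert (1 : R) X)

theorem cohomDesc_unit (X : RightComod R C) [QuasiFinite X] (f : X ⟶ tensor W X) :
    LinearMap.rTensor X.carrier (show X.Coend →ₗ[R] W from X.cohomDesc f) ∘ₗ X.coendUnit.lin =
      f.lin := by
  have h : X.cohomAdj.unit.app X ≫ X.tensorFunctor.map
      ((X.cohomAdj.homEquiv X (ModuleCat.of R W)).symm f) = f :=
    (X.cohomAdj.homEquiv_unit X (ModuleCat.of R W) _).symm.trans (Equiv.apply_symm_apply _ _)
  exact congrArg Hom.lin h

theorem coend_hom_ext (X : RightComod R C) [QuasiFinite X] (f g : X.Coend →ₗ[R] W)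
    (h : f.rTensor X.carrier ∘ₗ X.coendUnit.lin = g.rTensor X.carrier ∘ₗ X.coendUnit.lin) :
    f = g := by
  have h' : (X.cohomAdj.homEquiv X (ModuleCat.of R W)) (ModuleCat.ofHom f) =
      (X.cohomAdj.homEquiv X (ModuleCat.of R W)) (ModuleCat.ofHom g) := by
    rw [Adjunction.homEquiv_unit, Adjunction.homEquiv_unit]
    exact hom_ext h
  exact congrArg ModuleCat.Hom.hom (Equiv.injective _ h')

/-- The coendomorphism coalgebra of a quasi-finite right comodule. -/
noncomputable instance coendCoalgebra (X : RightComod R C) [QuasiFinite X] :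
    Coalgebra R X.Coend where
  comul := X.coendComul
  counit := X.coendCounit
  coassoc := Coact.coend_right_coassoc X.coendUnit.lin X.coendComul
    X.coend_hom_ext (X.cohomDesc_unit _)
  rTensor_counit_comp_comul := Coact.coend_right_rTensor_counit X.coendUnit.lin X.coendComul
    X.coendCounit X.coend_hom_ext (X.cohomDesc_unit _) (X.cohomDesc_unit _)
  lTensor_counit_comp_comul := Coact.coend_right_lTensor_counit X.coendUnit.lin X.coendComul
    X.coendCounit X.coend_hom_ext (X.cohomDesc_unit _) (X.cohomDesc_unit _)

end Basic
end RightComod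

/-! ### Left comodules -/

/-- A left comodule over an `R`-coalgebra `C`. -/
structure LeftComod (R : Type u) [CommRing R] (C : Type u) [AddCommGroup C] [Module R C]
    [Coalgebra R C] where
  carrier : Type u
  [addCommGroup : AddCommGroup carrier]
  [module : Module R carrier]
  coact : carrier →ₗ[R] C ⊗[R] carrier
  coassoc : (TensorProduct.assoc R C C carrier).toLinearMap ∘ₗ
    (Coalgebra.comul (R := R) (A := C)).rTensor carrier ∘ₗ coact = coact.lTensor C ∘ₗ coact
  counit_coact : (Coalgebra.counit (R := R) (A := C)).rTensor carrier ∘ₗ coact =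
    TensorProduct.mk R R carrier 1

attribute [instance] LeftComod.addCommGroup LeftComod.module

namespace LeftComod

section Basic

variable {R : Type u} [CommRing R] {C : Type u} [AddCommGroup C] [Module R C] [Coalgebra R C]
  {V W : Type u} [AddCommGroup V] [Module R V] [AddCommGroup W] [Module R W]

/-- `C`-colinear maps. -/
@[ext]
structure Hom (M N : LeftComod R C) where
  lin : M.carrier →ₗ[R] N.carrier
  colinear : N.coact ∘ₗ lin = lin.lTensor C ∘ₗ M.coact

/-- The category of left `C`-comodules and `C`-colinear maps. -/
instance category : Category (LeftComod R C) where
  Hom M N := Hom M N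
  id M := ⟨LinearMap.id, by simp⟩
  comp {L M N} f g := ⟨g.lin ∘ₗ f.lin, by
    rw [← LinearMap.comp_assoc, g.colinear, LinearMap.comp_assoc, f.colinear,
      LinearMap.lTensor_comp, LinearMap.comp_assoc]⟩

@[ext]
theorem hom_ext {M N : LeftComod R C} {f g : M ⟶ N} (h : f.lin = g.lin) : f = g :=
  Hom.ext h

@[simp] theorem id_lin (M : LeftComod R C) : Hom.lin (𝟙 M) = LinearMap.id := rfl

@[simp] theorem comp_lin {L M N : LeftComod R C} (f : L ⟶ M) (g : M ⟶ N) :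
    (f ≫ g).lin = g.lin ∘ₗ f.lin := rfl

/-- `M ⊗ W` with the coaction `ϱ_M ⊗ id`, for an `R`-module `W`. -/
abbrev tensor (M : LeftComod R C) (W : Type u) [AddCommGroup W] [Module R W] :
    LeftComod R C where
  carrier := M.carrier ⊗[R] W
  coact := Coact.left M.coact W
  coassoc := Coact.left_coassoc _ _ M.coassoc
  counit_coact := Coact.left_counit _ _ M.counit_coact

/-- `id ⊗ g : M ⊗ V ⟶ M ⊗ W` for an `R`-linear map `g : V → W`. -/
def tensorMapRight
    (M : LeftComod R C) (g : V →ₗ[R] W) : tensor M V ⟶ tensor M W where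
  lin := g.lTensor M.carrier
  colinear := Coact.left_mapRight g M.coact

/-- `f ⊗ id : M ⊗ W ⟶ N ⊗ W` for a colinear map `f : M ⟶ N`. -/
def tensorMapLeft {M N : LeftComod R C} (f : M ⟶ N) (W : Type u) [AddCommGroup W] [Module R W] :
    tensor M W ⟶ tensor N W where
  lin := f.lin.rTensor W
  colinear := Coact.left_mapLeft f.lin M.coact N.coact f.colinear

/-- The colinear isomorphism `(M ⊗ V) ⊗ W ⟶ M ⊗ (V ⊗ W)`. -/
def tensorAssoc (M : LeftComod R C) (V W : Type u) [AddCommGroup V] [Module R V]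
    [AddCommGroup W] [Module R W] : tensor (tensor M V) W ⟶ tensor M (V ⊗[R] W) where
  lin := (TensorProduct.assoc R M.carrier V W).toLinearMap
  colinear := Coact.left_assoc M.coact

/-- For `w ∈ W` the colinear map `M ⟶ M ⊗ W`, `m ↦ m ⊗ w`. -/
def insert (M : LeftComod R C) (w : W) :
    M ⟶ tensor M W where
  lin := (TensorProduct.mk R M.carrier W).flip w
  colinear := Coact.left_insert M.coact w

/-- The functor `M ⊗ -` from `R`-modules to left `C`-comodules. -/
def tensorFunctor (M : LeftComod R C) : ModuleCat.{u} R ⥤ LeftComod R C where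
  obj W := tensor M W
  map g := tensorMapRight M g.hom
  map_id _ := hom_ext (LinearMap.lTensor_id _ _)
  map_comp f g := hom_ext (LinearMap.lTensor_comp _ g.hom f.hom)

/-- `M` is quasi-finite: the functor `M ⊗ -` has a left adjoint (the cohom functor). -/
abbrev QuasiFinite (M : LeftComod R C) : Prop := M.tensorFunctor.IsRightAdjoint

/-- `M` is an injector: the functor `M ⊗ -` respects injective objects. -/
def Injector (M : LeftComod R C) : Prop :=
  ∀ W : ModuleCat.{u} R, Injective W → Injective (M.tensorFunctor.obj W)

/-- The cohom functor of a quasi-finite comodule `X`. -/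
noncomputable def cohom (X : LeftComod R C) [QuasiFinite X] : LeftComod R C ⥤ ModuleCat.{u} R :=
  X.tensorFunctor.leftAdjoint

/-- The adjunction between the cohom functor and `X ⊗ -`. -/
noncomputable def cohomAdj (X : LeftComod R C) [QuasiFinite X] : X.cohom ⊣ X.tensorFunctor :=
  Adjunction.ofIsRightAdjoint X.tensorFunctor

/-- The `R`-linear map `h(X, M) → W` corresponding to a colinear map `M ⟶ X ⊗ W`. -/
noncomputable def cohomDesc (X : LeftComod R C) [QuasiFinite X] {M : LeftComod R C} (f : M ⟶ tensor X W) : X.cohom.obj M →ₗ[R] W :=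
  ((X.cohomAdj.homEquiv M (ModuleCat.of R W)).symm f).hom

/-- The underlying module `h(X, X)` of the coendomorphism coalgebra of `X`. -/
def Coend (X : LeftComod R C) [QuasiFinite X] : Type u := X.cohom.obj X

noncomputable instance (X : LeftComod R C) [QuasiFinite X] : AddCommGroup X.Coend :=
  inferInstanceAs (AddCommGroup (X.cohom.obj X))

noncomputable instance (X : LeftComod R C) [QuasiFinite X] : Module R X.Coend :=
  inferInstanceAs (Module R (X.cohom.obj X))

/-- The unit `X ⟶ X ⊗ h(X, X)` of the cohom adjunction. -/
noncomputable def coendUnit (X : LeftComod R C) [QuasiFinite X] : X ⟶ tensor X X.Coend :=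
  X.cohomAdj.unit.app X

/-- The comultiplication of `h(X, X)` corresponds to `(η ⊗ id) η : X ⟶ X ⊗ h(X, X) ⊗ h(X, X)`. -/
noncomputable def coendComul (X : LeftComod R C) [QuasiFinite X] :
    X.Coend →ₗ[R] X.Coend ⊗[R] X.Coend :=
  X.cohomDesc (X.coendUnit ≫ tensorMapLeft X.coendUnit X.Coend ≫
    tensorAssoc X X.Coend X.Coend)

/-- The counit of `h(X, X)` corresponds to the canonical map `X ⟶ X ⊗ R`. -/
noncomputable def coendCounit (X : LeftComod R C) [QuasiFinite X] : X.Coend →ₗ[R] R :=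
  X.cohomDesc (insert X (1 : R))

theorem cohomDesc_unit (X : LeftComod R C) [QuasiFinite X] (f : X ⟶ tensor X W) :
    LinearMap.lTensor X.carrier (show X.Coend →ₗ[R] W from X.cohomDesc f) ∘ₗ X.coendUnit.lin =
      f.lin := by
  have h : X.cohomAdj.unit.app X ≫ X.tensorFunctor.map
      ((X.cohomAdj.homEquiv X (ModuleCat.of R W)).symm f) = f :=
    (X.cohomAdj.homEquiv_unit X (ModuleCat.of R W) _).symm.trans (Equiv.apply_symm_apply _ _)
  exact congrArg Hom.lin h

theorem coend_hom_ext (X : LeftComod R C) [QuasiFinite X] (f g : X.Coend →ₗ[R] W)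
    (h : f.lTensor X.carrier ∘ₗ X.coendUnit.lin = g.lTensor X.carrier ∘ₗ X.coendUnit.lin) :
    f = g := by
  have h' : (X.cohomAdj.homEquiv X (ModuleCat.of R W)) (ModuleCat.ofHom f) =
      (X.cohomAdj.homEquiv X (ModuleCat.of R W)) (ModuleCat.ofHom g) := by
    rw [Adjunction.homEquiv_unit, Adjunction.homEquiv_unit]
    exact hom_ext h
  exact congrArg ModuleCat.Hom.hom (Equiv.injective _ h')

/-- The coendomorphism coalgebra of a quasi-finite left comodule. -/
noncomputable instance coendCoalgebra (X : LeftComod R C) [QuasiFinite X] :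
    Coalgebra R X.Coend where
  comul := X.coendComul
  counit := X.coendCounit
  coassoc := Coact.coend_left_coassoc X.coendUnit.lin X.coendComul
    X.coend_hom_ext (X.cohomDesc_unit _)
  rTensor_counit_comp_comul := Coact.coend_left_rTensor_counit X.coendUnit.lin X.coendComul
    X.coendCounit X.coend_hom_ext (X.cohomDesc_unit _) (X.cohomDesc_unit _)
  lTensor_counit_comp_comul := Coact.coend_left_lTensor_counit X.coendUnit.lin X.coendComul
    X.coendCounit X.coend_hom_ext (X.cohomDesc_unit _) (X.cohomDesc_unit _)

end Basic
end LeftComod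

/-! ### The cotensor product and coflatness -/

section Cotensor

variable {R : Type u} [CommRing R] {C : Type u} [AddCommGroup C] [Module R C] [Coalgebra R C]

/-- The map `ϱ_M ⊗ id - id ⊗ ϱ_N : M ⊗ N → M ⊗ C ⊗ N`. -/
def cotensorDiff (M : RightComod R C) (N : LeftComod R C) :
    M.carrier ⊗[R] N.carrier →ₗ[R] M.carrier ⊗[R] (C ⊗[R] N.carrier) :=
  (TensorProduct.assoc R M.carrier C N.carrier).toLinearMap ∘ₗ M.coact.rTensor N.carrier -
    N.coact.lTensor M.carrier

/-- The cotensor product of a right and a left comodule, as a submodule of `M ⊗ N`. -/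
def cotensor (M : RightComod R C) (N : LeftComod R C) : Submodule R (M.carrier ⊗[R] N.carrier) :=
  LinearMap.ker (cotensorDiff M N)

theorem cotensorDiff_map {M M' : RightComod R C} {N N' : LeftComod R C} (f : M ⟶ M')
    (g : N ⟶ N') (z : M.carrier ⊗[R] N.carrier) :
    cotensorDiff M' N' (TensorProduct.map f.lin g.lin z) =
      TensorProduct.map f.lin (g.lin.lTensor C) (cotensorDiff M N z) := by
  induction z with
  | zero => simp
  | add a b ha hb => simp only [map_add, ha, hb]
  | tmul m n =>
    have hf := LinearMap.congr_fun f.colinear m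
    have hg := LinearMap.congr_fun g.colinear n
    simp only [LinearMap.comp_apply] at hf hg
    simp only [cotensorDiff, LinearMap.sub_apply, LinearMap.comp_apply, LinearEquiv.coe_coe,
      TensorProduct.map_tmul, LinearMap.rTensor_tmul, LinearMap.lTensor_tmul, map_sub, hf, hg]
    congr 1
    generalize M.coact m = y
    induction y <;> simp_all [TensorProduct.add_tmul]

/-- The map `f ⊗ g` restricted to cotensor products, for colinear maps `f` and `g`. -/
def cotensorMap {M M' : RightComod R C} {N N' : LeftComod R C} (f : M ⟶ M') (g : N ⟶ N') :
    cotensor M N →ₗ[R] cotensor M' N' :=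
  (TensorProduct.map f.lin g.lin).restrict fun z hz => by
    rw [cotensor, LinearMap.mem_ker] at hz ⊢
    rw [cotensorDiff_map, hz, map_zero]

theorem cotensorMap_id (M : RightComod R C) (N : LeftComod R C) :
    cotensorMap (𝟙 M) (𝟙 N) = LinearMap.id :=
  LinearMap.ext fun z => Subtype.ext (LinearMap.congr_fun TensorProduct.map_id z.1)

theorem cotensorMap_comp {M M' M'' : RightComod R C} {N N' N'' : LeftComod R C} (f : M ⟶ M')
    (f' : M' ⟶ M'') (g : N ⟶ N') (g' : N' ⟶ N'') :
    cotensorMap (f ≫ f') (g ≫ g') = cotensorMap f' g' ∘ₗ cotensorMap f g :=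
  LinearMap.ext fun z => Subtype.ext (LinearMap.congr_fun
    (TensorProduct.map_comp f'.lin g'.lin f.lin g.lin) z.1)

/-- The functor `M □ -` from left `C`-comodules to `R`-modules. -/
def RightComod.cotensorFunctor (M : RightComod R C) : LeftComod R C ⥤ ModuleCat.{u} R where
  obj N := ModuleCat.of R (cotensor M N)
  map g := ModuleCat.ofHom (cotensorMap (𝟙 M) g)
  map_id N := ModuleCat.hom_ext (cotensorMap_id M N)
  map_comp f g := ModuleCat.hom_ext (cotensorMap_comp (𝟙 M) (𝟙 M) f g)

/-- The functor `- □ N` from right `C`-comodules to `R`-modules. -/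
def LeftComod.cotensorFunctor (N : LeftComod R C) : RightComod R C ⥤ ModuleCat.{u} R where
  obj M := ModuleCat.of R (cotensor M N)
  map f := ModuleCat.ofHom (cotensorMap f (𝟙 N))
  map_id M := ModuleCat.hom_ext (cotensorMap_id M N)
  map_comp f g := ModuleCat.hom_ext (cotensorMap_comp f g (𝟙 N) (𝟙 N))

/-- `M` is coflat: the functor `M □ -` is exact. (For a coalgebra that is flat as an `R`-module,
exactness of a sequence of comodules means exactness of the underlying sequence of modules.) -/
def RightComod.Coflat (M : RightComod R C) : Prop :=
  ∀ ⦃N₁ N₂ N₃ : LeftComod R C⦄ (f : N₁ ⟶ N₂) (g : N₂ ⟶ N₃), Function.Exact f.lin g.lin →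
    Function.Exact (M.cotensorFunctor.map f) (M.cotensorFunctor.map g)

/-- `M` is faithfully coflat: the functor `M □ -` is exact and faithful. -/
def RightComod.FaithfullyCoflat (M : RightComod R C) : Prop :=
  M.Coflat ∧ M.cotensorFunctor.Faithful

/-- `N` is coflat: the functor `- □ N` is exact. (For a coalgebra that is flat as an `R`-module,
exactness of a sequence of comodules means exactness of the underlying sequence of modules.) -/
def LeftComod.Coflat (N : LeftComod R C) : Prop :=
  ∀ ⦃M₁ M₂ M₃ : RightComod R C⦄ (f : M₁ ⟶ M₂) (g : M₂ ⟶ M₃), Function.Exact f.lin g.lin →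
    Function.Exact (N.cotensorFunctor.map f) (N.cotensorFunctor.map g)

/-- `N` is faithfully coflat: the functor `- □ N` is exact and faithful. -/
def LeftComod.FaithfullyCoflat (N : LeftComod R C) : Prop :=
  N.Coflat ∧ N.cotensorFunctor.Faithful

end Cotensor

/-! ### Bicomodules -/

/-- A `C`-`D`-bicomodule: a left `C`-comodule and right `D`-comodule whose left coaction
`X → C ⊗ X` is right `D`-colinear. -/
structure Bicomod (R : Type u) [CommRing R] (C D : Type u) [AddCommGroup C] [Module R C]
    [Coalgebra R C] [AddCommGroup D] [Module R D] [Coalgebra R D] where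
  right : RightComod R D
  coactLeft : right.carrier →ₗ[R] C ⊗[R] right.carrier
  coassocLeft : (TensorProduct.assoc R C C right.carrier).toLinearMap ∘ₗ
    (Coalgebra.comul (R := R) (A := C)).rTensor right.carrier ∘ₗ coactLeft =
      coactLeft.lTensor C ∘ₗ coactLeft
  counitLeft : (Coalgebra.counit (R := R) (A := C)).rTensor right.carrier ∘ₗ coactLeft =
    TensorProduct.mk R R right.carrier 1
  colinear : (RightComod.tensor C right).coact ∘ₗ coactLeft =
    coactLeft.rTensor D ∘ₗ right.coact

/-- The underlying left comodule of a bicomodule. -/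
def Bicomod.left {R : Type u} [CommRing R] {C D : Type u} [AddCommGroup C] [Module R C]
    [Coalgebra R C] [AddCommGroup D] [Module R D] [Coalgebra R D] (X : Bicomod R C D) :
    LeftComod R C where
  carrier := X.right.carrier
  coact := X.coactLeft
  coassoc := X.coassocLeft
  counit_coact := X.counitLeft

/-! ### The bicomodule structure on the image of `C` under an equivalence -/

namespace RightComod

section Comparison

variable {R : Type u} [CommRing R] {C D : Type u} [AddCommGroup C] [Module R C] [Coalgebra R C]
  [AddCommGroup D] [Module R D] [Coalgebra R D]
  {V W : Type u} [AddCommGroup V] [Module R V] [AddCommGroup W] [Module R W]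

/-- The colinear map `W ⊗ M ⟶ N`, `w ⊗ m ↦ φ w m`, for an `R`-linear family `φ` of colinear maps
`M ⟶ N`. -/
def tensorDesc {M N : RightComod R C}
    (φ : W →ₗ[R] (M ⟶ N)) : tensor W M ⟶ N where
  lin := TensorProduct.lift
    { toFun := fun w => (φ w).lin
      map_add' := fun v w => by rw [map_add, add_lin]
      map_smul' := fun r w => by rw [map_smul, smul_lin, RingHom.id_apply] }
  colinear := by
    refine TensorProduct.ext' fun w m => ?_
    have h := LinearMap.congr_fun (φ w).colinear m
    simp only [LinearMap.comp_apply, Coact.right_tmul, TensorProduct.lift.tmul,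
      LinearMap.coe_mk, AddHom.coe_mk] at h ⊢
    rw [h]
    generalize M.coact m = y
    induction y <;> simp_all [TensorProduct.tmul_add]

theorem insert_tensorDesc {M N : RightComod R C}
    (φ : W →ₗ[R] (M ⟶ N)) (w : W) : insert w M ≫ tensorDesc φ = φ w := by
  ext m
  simp [insert, tensorDesc]

theorem tensor_hom_ext {M N : RightComod R C}
    {f g : tensor W M ⟶ N} (h : ∀ w : W, insert w M ≫ f = insert w M ≫ g) : f = g :=
  hom_ext (TensorProduct.ext' fun w m => LinearMap.congr_fun (congrArg Hom.lin (h w)) m)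

/-- The linear map `w ↦ (m ↦ w ⊗ m)`. -/
def insertLinear (W : Type u) [AddCommGroup W] [Module R W] (M : RightComod R C) :
    W →ₗ[R] (M ⟶ tensor W M) where
  toFun w := insert w M
  map_add' v w := hom_ext (map_add (TensorProduct.mk R W M.carrier) v w)
  map_smul' r w := hom_ext (map_smul (TensorProduct.mk R W M.carrier) r w)

/-- The canonical natural map `λ : W ⊗ F(M) ⟶ F(W ⊗ M)`, `w ⊗ x ↦ F(m ↦ w ⊗ m)(x)`, of an
`R`-linear functor `F`. -/
def comparison (F : RightComod R C ⥤ RightComod R D) [F.Additive] [F.Linear R]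
    (W : Type u) [AddCommGroup W] [Module R W] (M : RightComod R C) :
    tensor W (F.obj M) ⟶ F.obj (tensor W M) :=
  tensorDesc (F.mapLinearMap R ∘ₗ insertLinear W M)

theorem insert_comparison (F : RightComod R C ⥤ RightComod R D) [F.Additive] [F.Linear R]
    (w : W) (M : RightComod R C) :
    insert w (F.obj M) ≫ comparison F W M = F.map (insert w M) :=
  insert_tensorDesc _ w

theorem insert_tensorMapLeft (g : V →ₗ[R] W) (M : RightComod R C) (v : V) :
    insert v M ≫ tensorMapLeft g M = insert (g v) M := rfl

theorem insert_tensorMapRight {M N : RightComod R C}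
    (f : M ⟶ N) (w : W) : insert w M ≫ tensorMapRight W f = f ≫ insert w N := rfl

theorem insert_insert
    (v : V) (w : W) (M : RightComod R C) :
    insert w M ≫ insert v (tensor W M) ≫ tensorAssocInv V W M = insert (v ⊗ₜ[R] w) M := rfl

theorem comparison_natural_left (F : RightComod R C ⥤ RightComod R D) [F.Additive] [F.Linear R]
    (g : V →ₗ[R] W)
    (M : RightComod R C) :
    tensorMapLeft g (F.obj M) ≫ comparison F W M =
      comparison F V M ≫ F.map (tensorMapLeft g M) := by
  refine tensor_hom_ext fun v => ?_
  rw [← Category.assoc, insert_tensorMapLeft, insert_comparison, ← Category.assoc,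
    insert_comparison, ← F.map_comp, insert_tensorMapLeft]

theorem comparison_natural_right (F : RightComod R C ⥤ RightComod R D) [F.Additive] [F.Linear R]
    (W : Type u) [AddCommGroup W] [Module R W] {M N : RightComod R C} (f : M ⟶ N) :
    tensorMapRight W (F.map f) ≫ comparison F W N =
      comparison F W M ≫ F.map (tensorMapRight W f) := by
  refine tensor_hom_ext fun w => ?_
  rw [← Category.assoc, insert_tensorMapRight, Category.assoc, insert_comparison,
    ← Category.assoc, insert_comparison, ← F.map_comp, ← F.map_comp, insert_tensorMapRight]

theorem comparison_assoc (F : RightComod R C ⥤ RightComod R D) [F.Additive] [F.Linear R]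
    (V W : Type u) [AddCommGroup V] [Module R V] [AddCommGroup W] [Module R W]
    (M : RightComod R C) :
    tensorAssocInv V W (F.obj M) ≫ comparison F (V ⊗[R] W) M =
      tensorMapRight V (comparison F W M) ≫ comparison F V (tensor W M) ≫
        F.map (tensorAssocInv V W M) := by
  refine tensor_hom_ext fun v => tensor_hom_ext fun w => ?_
  have h1 : insert w (F.obj M) ≫ insert v (tensor W (F.obj M)) ≫ tensorAssocInv V W (F.obj M) ≫
      comparison F (V ⊗[R] W) M = F.map (insert (v ⊗ₜ[R] w) M) := by
    rw [← insert_comparison, ← insert_insert, Category.assoc, Category.assoc]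
  rw [h1, ← Category.assoc (insert v _), insert_tensorMapRight, Category.assoc,
    ← Category.assoc (insert w _), insert_comparison, ← Category.assoc (insert v _),
    insert_comparison, ← F.map_comp, ← F.map_comp, insert_insert]

/-- For an equivalence the canonical map `λ` is an isomorphism. -/
instance comparison_isIso (E : RightComod R C ≌ RightComod R D) [E.functor.Additive]
    [E.functor.Linear R] (W : Type u) [AddCommGroup W] [Module R W] (M : RightComod R C) :
    IsIso (comparison E.functor W M) := by
  let φ : W →ₗ[R] (M ⟶ E.inverse.obj (tensor W (E.functor.obj M))) :=
    Linear.leftComp R _ (E.toAdjunction.unit.app M) ∘ₗ E.inverse.mapLinearMap R ∘ₗ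
      insertLinear W (E.functor.obj M)
  have hφ : ∀ w, insert w M ≫ tensorDesc φ =
      E.toAdjunction.homEquiv _ _ (insert w (E.functor.obj M)) := fun w => by
    rw [insert_tensorDesc, Adjunction.homEquiv_unit]
    rfl
  refine ⟨(E.toAdjunction.homEquiv _ _).symm (tensorDesc φ), ?_, ?_⟩
  · refine tensor_hom_ext fun w => ?_
    rw [← Category.assoc, insert_comparison, ← Adjunction.homEquiv_naturality_left_symm, hφ,
      Equiv.symm_apply_apply, Category.comp_id]
  · apply (E.toAdjunction.homEquiv _ _).injective
    rw [Adjunction.homEquiv_naturality_right, Equiv.apply_symm_apply]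
    refine tensor_hom_ext fun w => ?_
    rw [← Category.assoc, hφ, ← Adjunction.homEquiv_naturality_right, insert_comparison,
      ← Adjunction.homEquiv_naturality_left, Category.comp_id]

/-- The comultiplication as a colinear map `C ⟶ C ⊗ C`. -/
def regularComul (R : Type u) [CommRing R] (C : Type u) [AddCommGroup C] [Module R C]
    [Coalgebra R C] : regular R C ⟶ tensor C (regular R C) where
  lin := Coalgebra.comul (R := R) (A := C)
  colinear := Coalgebra.coassoc_symm (R := R) (A := C)

theorem regularComul_coassoc (R : Type u) [CommRing R] (C : Type u) [AddCommGroup C] [Module R C]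
    [Coalgebra R C] :
    regularComul R C ≫ tensorMapLeft (Coalgebra.comul (R := R) (A := C)) (regular R C) =
      regularComul R C ≫ tensorMapRight C (regularComul R C) ≫
        tensorAssocInv C C (regular R C) :=
  hom_ext (Coalgebra.coassoc_symm (R := R) (A := C)).symm

theorem regularComul_counit (R : Type u) [CommRing R] (C : Type u) [AddCommGroup C] [Module R C]
    [Coalgebra R C] :
    regularComul R C ≫ tensorMapLeft (Coalgebra.counit (R := R) (A := C)) (regular R C) =
      insert (1 : R) (regular R C) :=
  hom_ext (Coalgebra.rTensor_counit_comp_comul (R := R) (A := C))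

/-- The left coaction `F(C) ⟶ C ⊗ F(C)`: the unique map whose composite with the canonical
isomorphism `λ : C ⊗ F(C) ⟶ F(C ⊗ C)` is `F(Δ)`. -/
noncomputable def imageCoact (E : RightComod R C ≌ RightComod R D) [E.functor.Additive]
    [E.functor.Linear R] :
    E.functor.obj (regular R C) ⟶ tensor C (E.functor.obj (regular R C)) :=
  E.functor.map (regularComul R C) ≫ inv (comparison E.functor C (regular R C))

theorem imageCoact_comparison (E : RightComod R C ≌ RightComod R D) [E.functor.Additive]
    [E.functor.Linear R] :
    imageCoact E ≫ comparison E.functor C (regular R C) = E.functor.map (regularComul R C) := by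
  rw [imageCoact, Category.assoc, IsIso.inv_hom_id, Category.comp_id]

theorem imageCoact_coassoc (E : RightComod R C ≌ RightComod R D) [E.functor.Additive]
    [E.functor.Linear R] :
    imageCoact E ≫ tensorMapLeft Coalgebra.comul (E.functor.obj (regular R C)) =
      imageCoact E ≫ tensorMapRight C (imageCoact E) ≫
        tensorAssocInv C C (E.functor.obj (regular R C)) := by
  rw [← cancel_mono (comparison E.functor (C ⊗[R] C) (regular R C))]
  simp only [Category.assoc]
  rw [comparison_natural_left, ← Category.assoc, imageCoact_comparison, comparison_assoc,
    ← Category.assoc (tensorMapRight C (imageCoact E))]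
  have h : tensorMapRight C (imageCoact E) ≫
      tensorMapRight C (comparison E.functor C (regular R C)) =
      tensorMapRight C (E.functor.map (regularComul R C)) := by
    rw [← imageCoact_comparison]
    exact hom_ext (LinearMap.lTensor_comp _ _ _).symm
  rw [h, ← Category.assoc (tensorMapRight C _), comparison_natural_right, Category.assoc,
    ← Category.assoc, imageCoact_comparison, ← E.functor.map_comp, ← E.functor.map_comp,
    ← E.functor.map_comp]
  rw [regularComul_coassoc]

theorem imageCoact_counit (E : RightComod R C ≌ RightComod R D) [E.functor.Additive]
    [E.functor.Linear R] :
    imageCoact E ≫ tensorMapLeft Coalgebra.counit (E.functor.obj (regular R C)) =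
      insert (1 : R) (E.functor.obj (regular R C)) := by
  rw [← cancel_mono (comparison E.functor R (regular R C)), Category.assoc,
    comparison_natural_left, ← Category.assoc, imageCoact_comparison, insert_comparison,
    ← E.functor.map_comp, regularComul_counit]

/-- The `C`-`D`-bicomodule `F(C)` of an `R`-linear equivalence `F` from right `C`-comodules to
right `D`-comodules. -/
noncomputable def _root_.imageBicomod (E : RightComod R C ≌ RightComod R D) [E.functor.Additive]
    [E.functor.Linear R] : Bicomod R C D where
  right := E.functor.obj (regular R C)
  coactLeft := (imageCoact E).lin
  coassocLeft := by
    have h : Coalgebra.comul.rTensor _ ∘ₗ (imageCoact E).lin =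
        (TensorProduct.assoc R C C _).symm.toLinearMap ∘ₗ
          (imageCoact E).lin.lTensor C ∘ₗ (imageCoact E).lin :=
      congrArg Hom.lin (imageCoact_coassoc E)
    rw [h, ← LinearMap.comp_assoc, LinearEquiv.comp_symm, LinearMap.id_comp]
  counitLeft := congrArg Hom.lin (imageCoact_counit E)
  colinear := (imageCoact E).colinear

instance symm_functor_additive (E : RightComod R C ≌ RightComod R D) [E.functor.Additive] :
    E.symm.functor.Additive :=
  inferInstanceAs E.inverse.Additive

instance symm_functor_linear (E : RightComod R C ≌ RightComod R D) [E.functor.Additive]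
    [E.functor.Linear R] : E.symm.functor.Linear R :=
  inferInstanceAs (E.inverse.Linear R)

end Comparison
end RightComod

/-! Write X = F(C) and Y = G(D).

The right structure of X comes from λ. The isomorphisms W ⊗ F(M) ≅ F(W ⊗ M) show that - ⊗ X is the
cofree functor - ⊗ C followed by F. The cofree functor is right adjoint to the forgetful functor, so
- ⊗ X has the left adjoint "apply G, then forget" (`imageAdj`), and X is quasi-finite. As C is flat,
monomorphisms of comodules are injective, so this left adjoint preserves monomorphisms and X is an
injector. As F is fully faithful, colinear maps X ⟶ W ⊗ X ≅ F(W ⊗ C) are the same as colinear maps C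
⟶ W ⊗ C, hence as linear maps C → W. Thus C has the universal property of h(X, X), and the coalgebra
structures agree because the left coaction on X is coassociative and counital (`coend_image`).

For coflatness over C, present M as the kernel of M ⊗ C → M ⊗ C ⊗ C. Over flat coalgebras exactness
of the underlying modules can be phrased inside the comodule category (`exact_iff`), so F preserves
it. Together with λ this identifies F(M) with M □ X (`exact_theta`), so - □ X is F followed by the
forgetful functor, which is exact and faithful (`image_left_coflat`).

The remaining claims follow once X □ - is known to be an equivalence from left D-comodules to left
C-comodules with inverse Y □ -. Taking M = Y gives D ≅ FG(D) ≅ Y □ X, compatibly with both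
D-coactions. Since λ exists for every module W, the kernel that defines Y □ X stays a kernel after W
⊗ - (`lTensor_exact_theta`). This purity and the flatness of Y give Y □ (X □ N) ≅ (Y □ X) □ N ≅ D □
N ≅ N (`range_embedding`); the other composite is the same statement for G. Now the first argument
repeats on the left: X ⊗ W ≅ X □ (D ⊗ W), so X ⊗ - has a left adjoint that preserves monomorphisms,
and linear maps D → W classify colinear maps X ⟶ X ⊗ W. Finally X □ - is exact and faithful because
it is an equivalence.

The claims about G(D) are those about F(C) for the inverse equivalence. -/

namespace RightComod

/-! ### Kernels, exactness and cofree objects for right comodules -/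

section Exactness

variable {R : Type u} [CommRing R] {C : Type u} [AddCommGroup C] [Module R C] [Coalgebra R C]

@[simp] theorem zero_lin (M N : RightComod R C) : Hom.lin (0 : M ⟶ N) = 0 := rfl

@[simp] theorem sub_lin {M N : RightComod R C} (f g : M ⟶ N) : (f - g).lin = f.lin - g.lin := by
  rw [sub_eq_add_neg, sub_eq_add_neg]
  rfl

/-- The comodule structure induced on a module `K` embedded in `M` compatibly with the coaction. -/
noncomputable def ofInjective [Module.Flat R C] (M : RightComod R C) (K : Type u)
    [AddCommGroup K] [Module R K] (i : K →ₗ[R] M.carrier) (hi : Function.Injective i)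
    (h : ∀ k, M.coact (i k) ∈ LinearMap.range (i.rTensor C)) : RightComod R C :=
  have hc : i.rTensor C ∘ₗ LinearMap.codRestrictOfInjective (M.coact ∘ₗ i) (i.rTensor C)
      (Module.Flat.rTensor_preserves_injective_linearMap i hi) h = M.coact ∘ₗ i :=
    LinearMap.codRestrictOfInjective_comp _ _ _ _
  { carrier := K
    coact := LinearMap.codRestrictOfInjective (M.coact ∘ₗ i) (i.rTensor C)
      (Module.Flat.rTensor_preserves_injective_linearMap i hi) h
    coassoc := by
      -- From here on only the relation (i ⊗ C) ρ = ϱ i is used. Flatness makes i ⊗ (C ⊗ C)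
      -- injective, so coassociativity may be checked in M.
      generalize LinearMap.codRestrictOfInjective (M.coact ∘ₗ i) (i.rTensor C) _ h = ρ at hc
      have hinj : Function.Injective (i.rTensor (C ⊗[R] C)) :=
        Module.Flat.rTensor_preserves_injective_linearMap i hi
      refine LinearMap.ext fun k => hinj ?_
      have hk : ∀ k, i.rTensor C (ρ k) = M.coact (i k) := fun k => LinearMap.congr_fun hc k
      have hM := LinearMap.congr_fun M.coassoc (i k)
      simp only [LinearMap.comp_apply, LinearEquiv.coe_coe] at hM ⊢
      rw [← hk] at hM
      have h1 : ∀ y : K ⊗[R] C, i.rTensor (C ⊗[R] C) (TensorProduct.assoc R K C C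
          (ρ.rTensor C y)) = TensorProduct.assoc R _ C C (M.coact.rTensor C (i.rTensor C y)) := by
        intro y
        induction y with
        | zero => simp
        | add a b ha hb => simp only [map_add, ha, hb]
        | tmul a c =>
          simp only [LinearMap.rTensor_tmul, ← hk]
          generalize ρ a = z
          induction z <;> simp_all [TensorProduct.add_tmul]
      rw [h1, hM]
      rw [← LinearMap.comp_apply, ← LinearMap.comp_apply (LinearMap.rTensor _ i),
        LinearMap.lTensor_comp_rTensor, LinearMap.rTensor_comp_lTensor]
    counit_coact := by
      generalize LinearMap.codRestrictOfInjective (M.coact ∘ₗ i) (i.rTensor C) _ h = ρ at hc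
      have hinj : Function.Injective (i.rTensor R) :=
        Module.Flat.rTensor_preserves_injective_linearMap i hi
      refine LinearMap.ext fun k => hinj ?_
      have hM := LinearMap.congr_fun M.counit_coact (i k)
      have hk : i.rTensor C (ρ k) = M.coact (i k) := LinearMap.congr_fun hc k
      simp only [LinearMap.comp_apply] at hM ⊢
      rw [← LinearMap.comp_apply (i.rTensor R), LinearMap.rTensor_comp_lTensor,
        ← LinearMap.lTensor_comp_rTensor, LinearMap.comp_apply, hk, hM]
      simp }

/-- The embedding of `ofInjective` as a colinear map. -/
noncomputable def ofInjectiveι [Module.Flat R C] (M : RightComod R C) (K : Type u)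
    [AddCommGroup K] [Module R K] (i : K →ₗ[R] M.carrier) (hi : Function.Injective i)
    (h : ∀ k, M.coact (i k) ∈ LinearMap.range (i.rTensor C)) : ofInjective M K i hi h ⟶ M where
  lin := i
  colinear := (LinearMap.codRestrictOfInjective_comp _ _ _ _).symm

/-- Flatness of C makes ker g ⊗ C the kernel of g ⊗ C, and colinearity of g shows that ϱ sends ker g
into that kernel. -/
theorem coact_mem_range [Module.Flat R C] {M N : RightComod R C} (g : M ⟶ N)
    (k : LinearMap.ker g.lin) :
    M.coact ((LinearMap.ker g.lin).subtype k) ∈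
      LinearMap.range ((LinearMap.ker g.lin).subtype.rTensor C) := by
  have h := Module.Flat.rTensor_exact C (g.lin.exact_subtype_ker_map)
  refine (h _).1 ?_
  rw [← LinearMap.comp_apply, ← g.colinear, LinearMap.comp_apply]
  exact (congrArg _ k.2).trans (map_zero _)

/-- The kernel of a colinear map, over a flat coalgebra. -/
noncomputable def ker [Module.Flat R C] {M N : RightComod R C} (g : M ⟶ N) : RightComod R C :=
  ofInjective M (LinearMap.ker g.lin) (LinearMap.ker g.lin).subtype
    (Submodule.subtype_injective _) (coact_mem_range g)

/-- The inclusion of the kernel. -/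
noncomputable def kerι [Module.Flat R C] {M N : RightComod R C} (g : M ⟶ N) : ker g ⟶ M :=
  ofInjectiveι M _ _ _ _

theorem kerι_lin [Module.Flat R C] {M N : RightComod R C} (g : M ⟶ N) :
    (kerι g).lin = (LinearMap.ker g.lin).subtype := rfl

/-- A colinear map with values in the range of an injective colinear map factors through it. -/
noncomputable def lift [Module.Flat R C] {K M N : RightComod R C} (i : K ⟶ N)
    (hi : Function.Injective i.lin) (f : M ⟶ N) (h : ∀ x, f.lin x ∈ LinearMap.range i.lin) :
    M ⟶ K where
  lin := LinearMap.codRestrictOfInjective f.lin i.lin hi h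
  colinear := by
    have hinj : Function.Injective (i.lin.rTensor C) :=
      Module.Flat.rTensor_preserves_injective_linearMap i.lin hi
    have hc := LinearMap.codRestrictOfInjective_comp f.lin i.lin hi h
    refine LinearMap.ext fun k => hinj ?_
    rw [← LinearMap.comp_apply, ← LinearMap.comp_assoc, ← i.colinear, LinearMap.comp_assoc, hc,
      ← LinearMap.comp_apply (i.lin.rTensor C), ← LinearMap.comp_assoc, ← LinearMap.rTensor_comp,
      hc, f.colinear]

theorem lift_comp [Module.Flat R C] {K M N : RightComod R C} (i : K ⟶ N)
    (hi : Function.Injective i.lin) (f : M ⟶ N) (h : ∀ x, f.lin x ∈ LinearMap.range i.lin) :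
    lift i hi f h ≫ i = f :=
  hom_ext (LinearMap.codRestrictOfInjective_comp f.lin i.lin hi h)

/-- The quotient of a comodule by the image of a colinear map. -/
noncomputable def coker {M N : RightComod R C} (f : M ⟶ N) : RightComod R C :=
  -- By colinearity the coaction of N carries the image of f into the image of f ⊗ C, which vanishes
  -- in coker(f) ⊗ C. Quotients thus need no flatness.
  have h : LinearMap.range f.lin ≤
      LinearMap.ker ((LinearMap.range f.lin).mkQ.rTensor C ∘ₗ N.coact) := by
    rintro _ ⟨x, rfl⟩
    rw [LinearMap.mem_ker, ← LinearMap.comp_apply, LinearMap.comp_assoc, f.colinear,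
      ← LinearMap.comp_assoc, ← LinearMap.rTensor_comp, LinearMap.range_mkQ_comp]
    simp
  { carrier := N.carrier ⧸ LinearMap.range f.lin
    coact := (LinearMap.range f.lin).liftQ ((LinearMap.range f.lin).mkQ.rTensor C ∘ₗ N.coact) h
    coassoc := by
      have hc := (LinearMap.range f.lin).liftQ_mkQ _ h
      generalize (LinearMap.range f.lin).liftQ _ h = ρ at hc
      refine Submodule.linearMap_qext _ (LinearMap.ext fun x => ?_)
      have hM := LinearMap.congr_fun N.coassoc x
      have hk : ∀ k, ρ ((LinearMap.range f.lin).mkQ k) =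
        (LinearMap.range f.lin).mkQ.rTensor C (N.coact k) := fun k => LinearMap.congr_fun hc k
      simp only [LinearMap.comp_apply, LinearEquiv.coe_coe] at hM ⊢
      rw [hk, ← LinearMap.comp_apply (LinearMap.lTensor _ _), LinearMap.lTensor_comp_rTensor,
        ← LinearMap.rTensor_comp_lTensor, LinearMap.comp_apply, ← hM]
      generalize N.coact x = y
      induction y with
      | zero => simp
      | add a b ha hb => simp only [map_add, ha, hb]
      | tmul a c =>
        simp only [LinearMap.rTensor_tmul, hk]
        generalize N.coact a = z
        induction z <;> simp_all [TensorProduct.add_tmul]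
    counit_coact := by
      have hc := (LinearMap.range f.lin).liftQ_mkQ _ h
      generalize (LinearMap.range f.lin).liftQ _ h = ρ at hc
      refine Submodule.linearMap_qext _ (LinearMap.ext fun x => ?_)
      have hM := LinearMap.congr_fun N.counit_coact x
      have hk : ρ ((LinearMap.range f.lin).mkQ x) =
        (LinearMap.range f.lin).mkQ.rTensor C (N.coact x) := LinearMap.congr_fun hc x
      simp only [LinearMap.comp_apply] at hM ⊢
      rw [hk, ← LinearMap.comp_apply (LinearMap.lTensor _ _), LinearMap.lTensor_comp_rTensor,
        ← LinearMap.rTensor_comp_lTensor, LinearMap.comp_apply, hM]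
      simp }

/-- The projection onto the cokernel. -/
noncomputable def cokerπ {M N : RightComod R C} (f : M ⟶ N) : N ⟶ coker f where
  lin := (LinearMap.range f.lin).mkQ
  colinear := (LinearMap.range f.lin).liftQ_mkQ _ _

theorem cokerπ_lin {M N : RightComod R C} (f : M ⟶ N) :
    (cokerπ f).lin = (LinearMap.range f.lin).mkQ := rfl

/-- Exactness of the underlying linear maps in terms of the category of comodules. -/
theorem exact_iff [Module.Flat R C] {L M N : RightComod R C} (f : L ⟶ M) (g : M ⟶ N) :
    Function.Exact f.lin g.lin ↔ f ≫ g = 0 ∧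
      ∀ (T Q : RightComod R C) (h : T ⟶ M) (u : M ⟶ Q), h ≫ g = 0 → f ≫ u = 0 → h ≫ u = 0 := by
  constructor
  · intro H
    refine ⟨hom_ext H.linearMap_comp_eq_zero, fun T Q h u hg hu => hom_ext ?_⟩
    ext t
    obtain ⟨x, hx⟩ := (H (h.lin t)).1 (LinearMap.congr_fun (congrArg Hom.lin hg) t)
    rw [comp_lin, LinearMap.comp_apply, ← hx]
    exact LinearMap.congr_fun (congrArg Hom.lin hu) x
  · rintro ⟨h0, H⟩
    -- The condition is tested on the kernel inclusion and the cokernel projection: their composite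
    -- vanishes exactly when ker g lies in the range of f.
    have h1 : kerι g ≫ g = 0 := hom_ext (LinearMap.ext fun x => x.2)
    have h2 : f ≫ cokerπ f = 0 := hom_ext (LinearMap.range_mkQ_comp f.lin)
    have h3 := congrArg Hom.lin (H _ _ _ _ h1 h2)
    intro y
    constructor
    · intro hy
      have := LinearMap.congr_fun h3 ⟨y, hy⟩
      exact (Submodule.Quotient.mk_eq_zero _).1 this
    · rintro ⟨x, rfl⟩
      exact LinearMap.congr_fun (congrArg Hom.lin h0) x

/-- A monomorphism cannot distinguish the inclusion of its kernel from zero; flatness is what makes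
the kernel a comodule. -/
theorem injective_of_mono [Module.Flat R C] {M N : RightComod R C} (f : M ⟶ N) [Mono f] :
    Function.Injective f.lin := by
  have h1 : kerι f ≫ f = 0 ≫ f := hom_ext (LinearMap.ext fun x => x.2.trans (by simp))
  have h2 := congrArg Hom.lin ((cancel_mono f).1 h1)
  rw [injective_iff_map_eq_zero]
  intro x hx
  exact LinearMap.congr_fun h2 ⟨x, hx⟩

theorem mono_of_injective {M N : RightComod R C} (f : M ⟶ N) (hf : Function.Injective f.lin) :
    Mono f :=
  ⟨fun _ _ e => hom_ext (LinearMap.ext fun x =>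
    hf (LinearMap.congr_fun (congrArg Hom.lin e) x))⟩

/-- The forgetful functor from comodules to modules. -/
def forgetful (R : Type u) [CommRing R] (C : Type u) [AddCommGroup C] [Module R C]
    [Coalgebra R C] : RightComod R C ⥤ ModuleCat.{u} R where
  obj M := ModuleCat.of R M.carrier
  map f := ModuleCat.ofHom f.lin

/-- The coaction of `M` as a colinear map `M ⟶ M ⊗ C`. -/
def coactHom (M : RightComod R C) : M ⟶ tensor M.carrier (regular R C) where
  lin := M.coact
  colinear := LinearMap.ext fun x =>
    (LinearEquiv.symm_apply_eq (TensorProduct.assoc R M.carrier C C)).2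
      (LinearMap.congr_fun M.coassoc x).symm

theorem coactHom_naturality {M N : RightComod R C} (f : M ⟶ N) :
    f ≫ coactHom N = coactHom M ≫ tensorMapLeft f.lin (regular R C) :=
  hom_ext f.colinear

/-- The counit provides a retraction of the coaction. -/
theorem coact_injective (M : RightComod R C) : Function.Injective M.coact := by
  intro x y h
  have hx := LinearMap.congr_fun M.counit_coact x
  have hy := LinearMap.congr_fun M.counit_coact y
  rw [LinearMap.comp_apply, h, ← LinearMap.comp_apply, hy] at hx
  simpa using congrArg (TensorProduct.rid R M.carrier) hx.symm

/-- The difference of the two maps `M ⊗ C ⟶ M ⊗ C ⊗ C` whose kernel is `M`. -/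
def cobarDiff (M : RightComod R C) :
    tensor M.carrier (regular R C) ⟶ tensor (M.carrier ⊗[R] C) (regular R C) :=
  tensorMapLeft M.coact (regular R C) -
    tensorMapRight M.carrier (regularComul R C) ≫ tensorAssocInv M.carrier C (regular R C)

/-- The sequence M → M ⊗ C → M ⊗ C ⊗ C is contracted by the counit on the last factor. It presents
every comodule as a kernel between cofree ones, which is how an equivalence can be computed from its
value at C. -/
theorem exact_coactHom (M : RightComod R C) :
    Function.Exact (coactHom M).lin (cobarDiff M).lin := by
  have hd : ∀ z, (cobarDiff M).lin z = M.coact.rTensor C z -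
      (TensorProduct.assoc R M.carrier C C).symm
        ((Coalgebra.comul (R := R) (A := C)).lTensor M.carrier z) := fun z => by
    rw [cobarDiff, sub_lin]
    rfl
  intro z
  rw [hd]
  refine sub_eq_zero.trans ?_
  constructor
  · intro h
    -- If (ϱ ⊗ id) z = (id ⊗ Δ) z, applying ε to the last factor turns the left side into ϱ((id ⊗ ε)
    -- z) and the right side into z; this gives the witness.
    refine ⟨TensorProduct.rid R _ ((Coalgebra.counit (R := R) (A := C)).lTensor M.carrier z), ?_⟩
    have h1 : ∀ y : M.carrier ⊗[R] C, TensorProduct.rid R _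
        ((Coalgebra.counit (R := R) (A := C)).lTensor _ (M.coact.rTensor C y)) =
        M.coact (TensorProduct.rid R _
          ((Coalgebra.counit (R := R) (A := C)).lTensor M.carrier y)) := by
      intro y
      induction y with
      | zero => simp
      | add a b ha hb => simp only [map_add, ha, hb]
      | tmul a c => simp
    have h2 : ∀ y : M.carrier ⊗[R] C, TensorProduct.rid R _
        ((Coalgebra.counit (R := R) (A := C)).lTensor _
          ((TensorProduct.assoc R M.carrier C C).symm
            ((Coalgebra.comul (R := R) (A := C)).lTensor M.carrier y))) = y := by
      intro y
      induction y with
      | zero => simp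
      | add a b ha hb => simp only [map_add, ha, hb]
      | tmul a c =>
        have h3 : ∀ t : C ⊗[R] C, TensorProduct.rid R _
          ((Coalgebra.counit (R := R) (A := C)).lTensor _
            ((TensorProduct.assoc R M.carrier C C).symm (a ⊗ₜ t))) =
              a ⊗ₜ[R] TensorProduct.rid R _ ((Coalgebra.counit (R := R) (A := C)).lTensor C t) := by
          intro t
          induction t with
          | zero => simp
          | add a b ha hb => simp only [map_add, TensorProduct.tmul_add, ha, hb]
          | tmul a c => simp
        rw [LinearMap.lTensor_tmul, h3, Coalgebra.lTensor_counit_comul]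
        simp
    exact (h1 z).symm.trans ((congrArg _ (congrArg _ h)).trans (h2 z))
  · rintro ⟨x, rfl⟩
    exact ((LinearEquiv.symm_apply_eq (TensorProduct.assoc R M.carrier C C)).2
      (LinearMap.congr_fun M.coassoc x).symm).symm

/-- Linear maps `M → W` correspond to colinear maps `M ⟶ W ⊗ C`. -/
def cofreeEquiv (M : RightComod R C) (W : Type u) [AddCommGroup W] [Module R W] :
    (M.carrier →ₗ[R] W) ≃ (M ⟶ tensor W (regular R C)) where
  toFun f := coactHom M ≫ tensorMapLeft f (regular R C)
  invFun g := (TensorProduct.rid R W).toLinearMap ∘ₗ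
    (Coalgebra.counit (R := R) (A := C)).lTensor W ∘ₗ g.lin
  left_inv f := by
    ext x
    have h : ∀ y : M.carrier ⊗[R] C, (TensorProduct.rid R W)
        ((Coalgebra.counit (R := R) (A := C)).lTensor W (f.rTensor C y)) =
        f (TensorProduct.rid R _ ((Coalgebra.counit (R := R) (A := C)).lTensor _ y)) := by
      intro y
      induction y with
      | zero => simp
      | add a b ha hb => simp only [map_add, ha, hb]
      | tmul a c => simp
    refine (h (M.coact x)).trans ?_
    rw [← LinearMap.comp_apply (LinearMap.lTensor _ _), M.counit_coact]
    simp
  right_inv g := by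
    refine hom_ext (LinearMap.ext fun x => ?_)
    -- Here ε is applied to the first of the two factors produced by Δ, so the left counit law makes
    -- the composite the identity. Colinearity of g then brings the goal to this form.
    have h : ∀ y : W ⊗[R] C, ((TensorProduct.rid R W).toLinearMap ∘ₗ
        (Coalgebra.counit (R := R) (A := C)).lTensor W).rTensor C
          (Coact.right W (Coalgebra.comul (R := R) (A := C)) y) = y := by
      intro y
      induction y with
      | zero => simp
      | add a b ha hb => simp only [map_add, ha, hb]
      | tmul a c =>
        rw [Coact.right_tmul]
        have h3 : ∀ t : C ⊗[R] C, ((TensorProduct.rid R W).toLinearMap ∘ₗ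
            (Coalgebra.counit (R := R) (A := C)).lTensor W).rTensor C
              ((TensorProduct.assoc R W C C).symm (a ⊗ₜ t)) =
              a ⊗ₜ[R] TensorProduct.lid R _ ((Coalgebra.counit (R := R) (A := C)).rTensor C t) := by
          intro t
          induction t with
          | zero => simp
          | add a b ha hb => simp only [map_add, TensorProduct.tmul_add, ha, hb]
          | tmul a c => simp [TensorProduct.smul_tmul]
        rw [h3, Coalgebra.rTensor_counit_comul]
        simp
    have hg := LinearMap.congr_fun g.colinear x
    refine Eq.trans ?_ ((congrArg _ hg.symm).trans (h (g.lin x)))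
    exact LinearMap.congr_fun (LinearMap.rTensor_comp C ((TensorProduct.rid R W).toLinearMap ∘ₗ
        (Coalgebra.counit (R := R) (A := C)).lTensor W) g.lin) (M.coact x)

/-- The forgetful functor is left adjoint to `- ⊗ C`. -/
def forgetfulAdj (R : Type u) [CommRing R] (C : Type u) [AddCommGroup C] [Module R C]
    [Coalgebra R C] : forgetful R C ⊣ (regular R C).tensorFunctor :=
  Adjunction.mkOfHomEquiv
    { homEquiv M W := ModuleCat.homEquiv.trans (cofreeEquiv M W)
      homEquiv_naturality_left_symm _ _ := rfl
      homEquiv_naturality_right {M V W} f g := by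
        refine hom_ext ?_
        change LinearMap.rTensor C (g.hom ∘ₗ f.hom) ∘ₗ M.coact = _
        rw [LinearMap.rTensor_comp]
        rfl }

/-- A right adjoint preserves injective objects when its left adjoint preserves monomorphisms; the
injector property of F(C) over D rests on this. -/
instance forgetful_preservesMono [Module.Flat R C] : (forgetful R C).PreservesMonomorphisms where
  preserves f _ := (ModuleCat.mono_iff_injective _).2 (injective_of_mono f)

/-- Over a flat coalgebra injectivity of a colinear map is the categorical notion of monomorphism,
which an equivalence preserves. -/
theorem injective_of_isEquivalence [Module.Flat R C] {D : Type u} [AddCommGroup D] [Module R D]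
    [Coalgebra R D] [Module.Flat R D] (F : RightComod R C ⥤ RightComod R D) [F.IsEquivalence]
    {M N : RightComod R C} (f : M ⟶ N) (hf : Function.Injective f.lin) :
    Function.Injective (F.map f).lin :=
  have := mono_of_injective f hf
  injective_of_mono _

/-- An additive equivalence of comodule categories preserves exactness. -/
theorem exact_map [Module.Flat R C] {D : Type u} [AddCommGroup D] [Module R D]
    [Coalgebra R D] [Module.Flat R D] (F : RightComod R C ⥤ RightComod R D) [F.IsEquivalence]
    [F.Additive] {L M N : RightComod R C} {f : L ⟶ M} {g : M ⟶ N}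
    (h : Function.Exact f.lin g.lin) : Function.Exact (F.map f).lin (F.map g).lin := by
  rw [exact_iff] at h ⊢
  refine ⟨by rw [← F.map_comp, h.1, F.map_zero], fun T Q a u ha hu => ?_⟩
  -- The test objects T and Q need not be images under F. They are replaced by isomorphic images,
  -- and the test maps are then pulled back by fullness.
  let e := F.objObjPreimageIso T
  let e' := F.objObjPreimageIso Q
  have h1 := h.2 _ _ (F.preimage (e.hom ≫ a)) (F.preimage (u ≫ e'.inv))
    (F.map_injective (by simp [ha])) (F.map_injective (by simp [reassoc_of% hu]))
  have h2 := congrArg F.map h1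
  simp only [F.map_comp, F.map_preimage, F.map_zero, Category.assoc] at h2
  simpa using e.inv ≫= h2 =≫ e'.hom

end Exactness
end RightComod

/-! ### Kernels, exactness and cofree objects for left comodules -/

namespace LeftComod

section Exactness

variable {R : Type u} [CommRing R] {C : Type u} [AddCommGroup C] [Module R C] [Coalgebra R C]

/-- The categorical form of exactness mentions only zero morphisms, and every equivalence preserves
these, so no addition of colinear maps is needed on the left side. -/
instance hasZeroMorphisms : Limits.HasZeroMorphisms (LeftComod R C) where
  zero M N := ⟨⟨0, by simp⟩⟩
  comp_zero f _ := hom_ext (LinearMap.zero_comp f.lin)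
  zero_comp _ _ _ f := hom_ext (LinearMap.comp_zero f.lin)

@[simp] theorem zero_lin (M N : LeftComod R C) : Hom.lin (0 : M ⟶ N) = 0 := rfl

/-- Naturality of Δ ⊗ - in the module. The coactions induced on submodules and on quotients both
inherit coassociativity through it. -/
theorem lTensor_lTensor_assoc {M N : Type u} [AddCommGroup M] [Module R M] [AddCommGroup N]
    [Module R N] (i : M →ₗ[R] N) (y : C ⊗[R] M) :
    (i.lTensor C).lTensor C (TensorProduct.assoc R C C M
      ((Coalgebra.comul (R := R) (A := C)).rTensor M y)) =
      TensorProduct.assoc R C C N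
        ((Coalgebra.comul (R := R) (A := C)).rTensor N (i.lTensor C y)) := by
  induction y with
  | zero => simp
  | add a b ha hb => simp only [map_add, ha, hb]
  | tmul c m =>
    simp only [LinearMap.rTensor_tmul, LinearMap.lTensor_tmul]
    generalize Coalgebra.comul (R := R) c = z
    induction z <;> simp_all [TensorProduct.add_tmul]

/-- The comodule structure induced on a module `K` embedded in `M` compatibly with the coaction. -/
noncomputable def ofInjective [Module.Flat R C] (M : LeftComod R C) (K : Type u)
    [AddCommGroup K] [Module R K] (i : K →ₗ[R] M.carrier) (hi : Function.Injective i)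
    (h : ∀ k, M.coact (i k) ∈ LinearMap.range (i.lTensor C)) : LeftComod R C :=
  have hc : i.lTensor C ∘ₗ LinearMap.codRestrictOfInjective (M.coact ∘ₗ i) (i.lTensor C)
      (Module.Flat.lTensor_preserves_injective_linearMap i hi) h = M.coact ∘ₗ i :=
    LinearMap.codRestrictOfInjective_comp _ _ _ _
  { carrier := K
    coact := LinearMap.codRestrictOfInjective (M.coact ∘ₗ i) (i.lTensor C)
      (Module.Flat.lTensor_preserves_injective_linearMap i hi) h
    coassoc := by
      generalize LinearMap.codRestrictOfInjective (M.coact ∘ₗ i) (i.lTensor C) _ h = ρ at hc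
      have hinj : Function.Injective ((i.lTensor C).lTensor C) :=
        Module.Flat.lTensor_preserves_injective_linearMap _
          (Module.Flat.lTensor_preserves_injective_linearMap i hi)
      refine LinearMap.ext fun k => hinj ?_
      have hk : i.lTensor C (ρ k) = M.coact (i k) := LinearMap.congr_fun hc k
      have hM := LinearMap.congr_fun M.coassoc (i k)
      simp only [LinearMap.comp_apply, LinearEquiv.coe_coe] at hM ⊢
      rw [← hk] at hM
      rw [lTensor_lTensor_assoc, hM, ← LinearMap.lTensor_comp_apply,
        ← LinearMap.lTensor_comp_apply, hc]
    counit_coact := by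
      generalize LinearMap.codRestrictOfInjective (M.coact ∘ₗ i) (i.lTensor C) _ h = ρ at hc
      have hinj : Function.Injective (i.lTensor R) :=
        Module.Flat.lTensor_preserves_injective_linearMap i hi
      refine LinearMap.ext fun k => hinj ?_
      have hM := LinearMap.congr_fun M.counit_coact (i k)
      have hk : i.lTensor C (ρ k) = M.coact (i k) := LinearMap.congr_fun hc k
      simp only [LinearMap.comp_apply] at hM ⊢
      rw [← LinearMap.comp_apply (i.lTensor R), LinearMap.lTensor_comp_rTensor,
        ← LinearMap.rTensor_comp_lTensor, LinearMap.comp_apply, hk, hM]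
      simp }

/-- The embedding of `ofInjective` as a colinear map. -/
noncomputable def ofInjectiveι [Module.Flat R C] (M : LeftComod R C) (K : Type u)
    [AddCommGroup K] [Module R K] (i : K →ₗ[R] M.carrier) (hi : Function.Injective i)
    (h : ∀ k, M.coact (i k) ∈ LinearMap.range (i.lTensor C)) : ofInjective M K i hi h ⟶ M where
  lin := i
  colinear := (LinearMap.codRestrictOfInjective_comp _ _ _ _).symm

theorem coact_mem_range [Module.Flat R C] {M N : LeftComod R C} (g : M ⟶ N)
    (k : LinearMap.ker g.lin) :
    M.coact ((LinearMap.ker g.lin).subtype k) ∈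
      LinearMap.range ((LinearMap.ker g.lin).subtype.lTensor C) := by
  have h := Module.Flat.lTensor_exact C (g.lin.exact_subtype_ker_map)
  refine (h _).1 ?_
  rw [← LinearMap.comp_apply, ← g.colinear, LinearMap.comp_apply]
  exact (congrArg _ k.2).trans (map_zero _)

/-- The kernel of a colinear map, over a flat coalgebra. -/
noncomputable def ker [Module.Flat R C] {M N : LeftComod R C} (g : M ⟶ N) : LeftComod R C :=
  ofInjective M (LinearMap.ker g.lin) (LinearMap.ker g.lin).subtype
    (Submodule.subtype_injective _) (coact_mem_range g)

/-- The inclusion of the kernel. -/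
noncomputable def kerι [Module.Flat R C] {M N : LeftComod R C} (g : M ⟶ N) : ker g ⟶ M :=
  ofInjectiveι M _ _ _ _

theorem kerι_lin [Module.Flat R C] {M N : LeftComod R C} (g : M ⟶ N) :
    (kerι g).lin = (LinearMap.ker g.lin).subtype := rfl

/-- A colinear map with values in the range of an injective colinear map factors through it. -/
noncomputable def lift [Module.Flat R C] {K M N : LeftComod R C} (i : K ⟶ N)
    (hi : Function.Injective i.lin) (f : M ⟶ N) (h : ∀ x, f.lin x ∈ LinearMap.range i.lin) :
    M ⟶ K where
  lin := LinearMap.codRestrictOfInjective f.lin i.lin hi h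
  colinear := by
    have hinj : Function.Injective (i.lin.lTensor C) :=
      Module.Flat.lTensor_preserves_injective_linearMap i.lin hi
    have hc := LinearMap.codRestrictOfInjective_comp f.lin i.lin hi h
    refine LinearMap.ext fun k => hinj ?_
    rw [← LinearMap.comp_apply, ← LinearMap.comp_assoc, ← i.colinear, LinearMap.comp_assoc, hc,
      ← LinearMap.comp_apply (i.lin.lTensor C), ← LinearMap.comp_assoc, ← LinearMap.lTensor_comp,
      hc, f.colinear]

theorem lift_comp [Module.Flat R C] {K M N : LeftComod R C} (i : K ⟶ N)
    (hi : Function.Injective i.lin) (f : M ⟶ N) (h : ∀ x, f.lin x ∈ LinearMap.range i.lin) :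
    lift i hi f h ≫ i = f :=
  hom_ext (LinearMap.codRestrictOfInjective_comp f.lin i.lin hi h)

/-- The quotient of a comodule by the image of a colinear map. -/
noncomputable def coker {M N : LeftComod R C} (f : M ⟶ N) : LeftComod R C :=
  have h : LinearMap.range f.lin ≤
      LinearMap.ker ((LinearMap.range f.lin).mkQ.lTensor C ∘ₗ N.coact) := by
    rintro _ ⟨x, rfl⟩
    rw [LinearMap.mem_ker, ← LinearMap.comp_apply, LinearMap.comp_assoc, f.colinear,
      ← LinearMap.comp_assoc, ← LinearMap.lTensor_comp, LinearMap.range_mkQ_comp]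
    simp
  { carrier := N.carrier ⧸ LinearMap.range f.lin
    coact := (LinearMap.range f.lin).liftQ ((LinearMap.range f.lin).mkQ.lTensor C ∘ₗ N.coact) h
    coassoc := by
      have hc := (LinearMap.range f.lin).liftQ_mkQ _ h
      generalize (LinearMap.range f.lin).liftQ _ h = ρ at hc
      refine Submodule.linearMap_qext _ (LinearMap.ext fun x => ?_)
      have hM := LinearMap.congr_fun N.coassoc x
      have hk : ρ ((LinearMap.range f.lin).mkQ x) =
        (LinearMap.range f.lin).mkQ.lTensor C (N.coact x) := LinearMap.congr_fun hc x
      simp only [LinearMap.comp_apply, LinearEquiv.coe_coe] at hM ⊢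
      rw [hk, ← lTensor_lTensor_assoc, hM, ← LinearMap.lTensor_comp_apply,
        ← LinearMap.lTensor_comp_apply, hc]
    counit_coact := by
      have hc := (LinearMap.range f.lin).liftQ_mkQ _ h
      generalize (LinearMap.range f.lin).liftQ _ h = ρ at hc
      refine Submodule.linearMap_qext _ (LinearMap.ext fun x => ?_)
      have hM := LinearMap.congr_fun N.counit_coact x
      have hk : ρ ((LinearMap.range f.lin).mkQ x) =
        (LinearMap.range f.lin).mkQ.lTensor C (N.coact x) := LinearMap.congr_fun hc x
      simp only [LinearMap.comp_apply] at hM ⊢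
      rw [hk, ← LinearMap.comp_apply (LinearMap.rTensor _ _), LinearMap.rTensor_comp_lTensor,
        ← LinearMap.lTensor_comp_rTensor, LinearMap.comp_apply, hM]
      simp }

/-- The projection onto the cokernel. -/
noncomputable def cokerπ {M N : LeftComod R C} (f : M ⟶ N) : N ⟶ coker f where
  lin := (LinearMap.range f.lin).mkQ
  colinear := (LinearMap.range f.lin).liftQ_mkQ _ _

theorem cokerπ_lin {M N : LeftComod R C} (f : M ⟶ N) :
    (cokerπ f).lin = (LinearMap.range f.lin).mkQ := rfl

/-- Exactness of the underlying linear maps in terms of the category of comodules. -/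
theorem exact_iff [Module.Flat R C] {L M N : LeftComod R C} (f : L ⟶ M) (g : M ⟶ N) :
    Function.Exact f.lin g.lin ↔ f ≫ g = 0 ∧
      ∀ (T Q : LeftComod R C) (h : T ⟶ M) (u : M ⟶ Q), h ≫ g = 0 → f ≫ u = 0 → h ≫ u = 0 := by
  constructor
  · intro H
    refine ⟨hom_ext H.linearMap_comp_eq_zero, fun T Q h u hg hu => hom_ext ?_⟩
    ext t
    obtain ⟨x, hx⟩ := (H (h.lin t)).1 (LinearMap.congr_fun (congrArg Hom.lin hg) t)
    rw [comp_lin, LinearMap.comp_apply, ← hx]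
    exact LinearMap.congr_fun (congrArg Hom.lin hu) x
  · rintro ⟨h0, H⟩
    have h1 : kerι g ≫ g = 0 := hom_ext (LinearMap.ext fun x => x.2)
    have h2 : f ≫ cokerπ f = 0 := hom_ext (LinearMap.range_mkQ_comp f.lin)
    have h3 := congrArg Hom.lin (H _ _ _ _ h1 h2)
    intro y
    constructor
    · intro hy
      have := LinearMap.congr_fun h3 ⟨y, hy⟩
      exact (Submodule.Quotient.mk_eq_zero _).1 this
    · rintro ⟨x, rfl⟩
      exact LinearMap.congr_fun (congrArg Hom.lin h0) x

theorem injective_of_mono [Module.Flat R C] {M N : LeftComod R C} (f : M ⟶ N) [Mono f] :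
    Function.Injective f.lin := by
  have h1 : kerι f ≫ f = 0 ≫ f := hom_ext (LinearMap.ext fun x => x.2.trans (by simp))
  have h2 := congrArg Hom.lin ((cancel_mono f).1 h1)
  rw [injective_iff_map_eq_zero]
  intro x hx
  exact LinearMap.congr_fun h2 ⟨x, hx⟩

theorem mono_of_injective {M N : LeftComod R C} (f : M ⟶ N) (hf : Function.Injective f.lin) :
    Mono f :=
  ⟨fun _ _ e => hom_ext (LinearMap.ext fun x =>
    hf (LinearMap.congr_fun (congrArg Hom.lin e) x))⟩

/-- The forgetful functor from comodules to modules. -/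
def forgetful (R : Type u) [CommRing R] (C : Type u) [AddCommGroup C] [Module R C]
    [Coalgebra R C] : LeftComod R C ⥤ ModuleCat.{u} R where
  obj M := ModuleCat.of R M.carrier
  map f := ModuleCat.ofHom f.lin

/-- `C` as a left comodule over itself. -/
def regular (R : Type u) [CommRing R] (C : Type u) [AddCommGroup C] [Module R C]
    [Coalgebra R C] : LeftComod R C where
  carrier := C
  coact := Coalgebra.comul
  coassoc := Coalgebra.coassoc
  counit_coact := Coalgebra.rTensor_counit_comp_comul

/-- The coaction of `M` as a colinear map `M ⟶ C ⊗ M`. -/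
def coactHom (M : LeftComod R C) : M ⟶ tensor (regular R C) M.carrier where
  lin := M.coact
  colinear := M.coassoc

theorem coact_injective (M : LeftComod R C) : Function.Injective M.coact := by
  intro x y h
  have hx := LinearMap.congr_fun M.counit_coact x
  have hy := LinearMap.congr_fun M.counit_coact y
  rw [LinearMap.comp_apply, h, ← LinearMap.comp_apply, hy] at hx
  simpa using congrArg (TensorProduct.lid R M.carrier) hx.symm

/-- This is C □ M ≅ M. If (Δ ⊗ id) z = (id ⊗ ϱ) z, then applying ε to the first factor gives z =
ϱ((ε ⊗ id) z). -/
theorem exact_coact (M : LeftComod R C) :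
    Function.Exact M.coact (cotensorDiff (RightComod.regular R C) M) := by
  have hd : ∀ z : C ⊗[R] M.carrier, cotensorDiff (RightComod.regular R C) M z =
      TensorProduct.assoc R C C M.carrier
        ((Coalgebra.comul (R := R) (A := C)).rTensor M.carrier z) - M.coact.lTensor C z :=
    fun z => rfl
  intro z
  refine (hd z ▸ sub_eq_zero).trans ?_
  constructor
  · intro h
    refine ⟨TensorProduct.lid R _ ((Coalgebra.counit (R := R) (A := C)).rTensor M.carrier z), ?_⟩
    have h1 : ∀ y : C ⊗[R] M.carrier, TensorProduct.lid R _
        ((Coalgebra.counit (R := R) (A := C)).rTensor _ (M.coact.lTensor C y)) =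
        M.coact (TensorProduct.lid R _
          ((Coalgebra.counit (R := R) (A := C)).rTensor M.carrier y)) := by
      intro y
      induction y with
      | zero => simp
      | add a b ha hb => simp only [map_add, ha, hb]
      | tmul a c => simp
    have h2 : ∀ y : C ⊗[R] M.carrier, TensorProduct.lid R _
        ((Coalgebra.counit (R := R) (A := C)).rTensor _
          (TensorProduct.assoc R C C M.carrier
            ((Coalgebra.comul (R := R) (A := C)).rTensor M.carrier y))) = y := by
      intro y
      induction y with
      | zero => simp
      | add a b ha hb => simp only [map_add, ha, hb]
      | tmul c a =>
        have h3 : ∀ t : C ⊗[R] C, TensorProduct.lid R _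
          ((Coalgebra.counit (R := R) (A := C)).rTensor _
            (TensorProduct.assoc R C C M.carrier (t ⊗ₜ a))) =
              TensorProduct.lid R _ ((Coalgebra.counit (R := R) (A := C)).rTensor C t) ⊗ₜ[R] a := by
          intro t
          induction t with
          | zero => simp
          | add a b ha hb => simp only [map_add, TensorProduct.add_tmul, ha, hb]
          | tmul a c => simp [TensorProduct.smul_tmul']
        rw [LinearMap.rTensor_tmul, h3, Coalgebra.rTensor_counit_comul]
        simp
    exact (h1 z).symm.trans ((congrArg _ (congrArg _ h.symm)).trans (h2 z))
  · rintro ⟨x, rfl⟩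
    exact LinearMap.congr_fun M.coassoc x

/-- Linear maps `M → W` correspond to colinear maps `M ⟶ C ⊗ W`. -/
def cofreeEquiv (M : LeftComod R C) (W : Type u) [AddCommGroup W] [Module R W] :
    (M.carrier →ₗ[R] W) ≃ (M ⟶ tensor (regular R C) W) where
  toFun f := coactHom M ≫ tensorMapRight (regular R C) f
  invFun g := (TensorProduct.lid R W).toLinearMap ∘ₗ
    (Coalgebra.counit (R := R) (A := C)).rTensor W ∘ₗ g.lin
  left_inv f := by
    ext x
    have h : ∀ y : C ⊗[R] M.carrier, (TensorProduct.lid R W)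
        ((Coalgebra.counit (R := R) (A := C)).rTensor W (f.lTensor C y)) =
        f (TensorProduct.lid R _ ((Coalgebra.counit (R := R) (A := C)).rTensor _ y)) := by
      intro y
      induction y with
      | zero => simp
      | add a b ha hb => simp only [map_add, ha, hb]
      | tmul a c => simp
    refine (h (M.coact x)).trans ?_
    rw [← LinearMap.comp_apply (LinearMap.rTensor _ _), M.counit_coact]
    simp
  right_inv g := by
    refine hom_ext (LinearMap.ext fun x => ?_)
    -- Here ε meets the second factor produced by Δ, so the right counit law applies.
    have h : ∀ y : C ⊗[R] W, ((TensorProduct.lid R W).toLinearMap ∘ₗ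
        (Coalgebra.counit (R := R) (A := C)).rTensor W).lTensor C
          (Coact.left (Coalgebra.comul (R := R) (A := C)) W y) = y := by
      intro y
      induction y with
      | zero => simp
      | add a b ha hb => simp only [map_add, ha, hb]
      | tmul c a =>
        rw [Coact.left_tmul]
        have h3 : ∀ t : C ⊗[R] C, ((TensorProduct.lid R W).toLinearMap ∘ₗ
            (Coalgebra.counit (R := R) (A := C)).rTensor W).lTensor C
              (TensorProduct.assoc R C C W (t ⊗ₜ a)) =
              TensorProduct.rid R _ ((Coalgebra.counit (R := R) (A := C)).lTensor C t) ⊗ₜ[R] a := by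
          intro t
          induction t with
          | zero => simp
          | add a b ha hb => simp only [map_add, TensorProduct.add_tmul, ha, hb]
          | tmul a c => simp [TensorProduct.smul_tmul]
        rw [h3, Coalgebra.lTensor_counit_comul]
        simp
    have hg := LinearMap.congr_fun g.colinear x
    refine Eq.trans ?_ ((congrArg _ hg.symm).trans (h (g.lin x)))
    exact LinearMap.congr_fun (LinearMap.lTensor_comp C ((TensorProduct.lid R W).toLinearMap ∘ₗ
        (Coalgebra.counit (R := R) (A := C)).rTensor W) g.lin) (M.coact x)

/-- The forgetful functor is left adjoint to `C ⊗ -`. -/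
def forgetfulAdj (R : Type u) [CommRing R] (C : Type u) [AddCommGroup C] [Module R C]
    [Coalgebra R C] : forgetful R C ⊣ (regular R C).tensorFunctor :=
  Adjunction.mkOfHomEquiv
    { homEquiv M W := ModuleCat.homEquiv.trans (cofreeEquiv M W)
      homEquiv_naturality_left_symm _ _ := rfl
      homEquiv_naturality_right {M V W} f g := by
        refine hom_ext ?_
        change LinearMap.lTensor C (g.hom ∘ₗ f.hom) ∘ₗ M.coact = _
        rw [LinearMap.lTensor_comp]
        rfl }

instance forgetful_preservesMono [Module.Flat R C] : (forgetful R C).PreservesMonomorphisms where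
  preserves f _ := (ModuleCat.mono_iff_injective _).2 (injective_of_mono f)

/-- An equivalence of comodule categories preserves exactness. -/
theorem exact_map [Module.Flat R C] {D : Type u} [AddCommGroup D] [Module R D]
    [Coalgebra R D] [Module.Flat R D] (F : LeftComod R C ⥤ LeftComod R D) [F.IsEquivalence]
    {L M N : LeftComod R C} {f : L ⟶ M} {g : M ⟶ N}
    (h : Function.Exact f.lin g.lin) : Function.Exact (F.map f).lin (F.map g).lin := by
  rw [exact_iff] at h ⊢
  refine ⟨by rw [← F.map_comp, h.1, F.map_zero], fun T Q a u ha hu => ?_⟩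
  let e := F.objObjPreimageIso T
  let e' := F.objObjPreimageIso Q
  have h1 := h.2 _ _ (F.preimage (e.hom ≫ a)) (F.preimage (u ≫ e'.inv))
    (F.map_injective (by simp [ha])) (F.map_injective (by simp [reassoc_of% hu]))
  have h2 := congrArg F.map h1
  simp only [F.map_comp, F.map_preimage, F.map_zero, Category.assoc] at h2
  simpa using e.inv ≫= h2 =≫ e'.hom

end Exactness
end LeftComod

/-! ### The right D-comodule F(C): quasi-finiteness, injector property, coendomorphisms -/

namespace RightComod

section Image

variable {R : Type u} [CommRing R] {C D : Type u} [AddCommGroup C] [Module R C] [Coalgebra R C]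
  [AddCommGroup D] [Module R D] [Coalgebra R D]

/-- Applied to the unit η of the cohom adjunction, this turns the relation (φ ⊗ id) η = a into
compatibility of φ with the comultiplications that η and a determine. -/
theorem map_rTensor_assoc_symm {V W M N : Type u} [AddCommGroup V] [Module R V] [AddCommGroup W]
    [Module R W] [AddCommGroup M] [Module R M] [AddCommGroup N] [Module R N] (φ : V →ₗ[R] W)
    (η : M →ₗ[R] V ⊗[R] N) :
    (TensorProduct.map φ φ).rTensor N ∘ₗ (TensorProduct.assoc R V V N).symm.toLinearMap ∘ₗ
        η.lTensor V =
      (TensorProduct.assoc R W W N).symm.toLinearMap ∘ₗ (φ.rTensor N ∘ₗ η).lTensor W ∘ₗ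
        φ.rTensor M := by
  refine TensorProduct.ext' fun v m => ?_
  simp only [LinearMap.lTensor_tmul, LinearMap.rTensor_tmul, LinearMap.comp_apply,
    LinearEquiv.coe_coe]
  generalize η m = y
  induction y <;> simp_all [TensorProduct.tmul_add]

/-- A coalgebra `V` with a coassociative and counital universal map `X ⟶ V ⊗ X` is isomorphic to
the coendomorphism coalgebra of `X`. -/
theorem coend_equiv_of_universal (X : RightComod R D) [X.QuasiFinite] (a : X ⟶ tensor C X)
    (ha : ∀ (W : Type u) [AddCommGroup W] [Module R W],
      Function.Bijective fun g : C →ₗ[R] W => a ≫ tensorMapLeft g X)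
    (hΔ : a ≫ tensorMapLeft Coalgebra.comul X = a ≫ tensorMapRight C a ≫ tensorAssocInv C C X)
    (hε : a ≫ tensorMapLeft Coalgebra.counit X = insert (1 : R) X) :
    Nonempty (X.Coend ≃ₗc[R] C) := by
  -- Both modules represent the functor W ↦ Hom(X, W ⊗ X). The maps φ and ψ carry one universal
  -- element to the other, so uniqueness makes them inverse to each other.
  let φ : X.Coend →ₗ[R] C := X.cohomDesc a
  have hφ : φ.rTensor X.carrier ∘ₗ X.coendUnit.lin = a.lin := X.cohomDesc_unit a
  obtain ⟨ψ, hψ⟩ := (ha X.Coend).2 X.coendUnit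
  replace hψ : ψ.rTensor X.carrier ∘ₗ a.lin = X.coendUnit.lin := congrArg Hom.lin hψ
  replace hΔ : (Coalgebra.comul (R := R) (A := C)).rTensor X.carrier ∘ₗ a.lin =
    (TensorProduct.assoc R C C X.carrier).symm.toLinearMap ∘ₗ a.lin.lTensor C ∘ₗ a.lin :=
    congrArg Hom.lin hΔ
  replace hε : (Coalgebra.counit (R := R) (A := C)).rTensor X.carrier ∘ₗ a.lin =
    TensorProduct.mk R R X.carrier 1 := congrArg Hom.lin hε
  have h1 : ψ ∘ₗ φ = LinearMap.id := by
    apply X.coend_hom_ext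
    rw [LinearMap.rTensor_comp, LinearMap.comp_assoc, hφ, hψ, LinearMap.rTensor_id,
      LinearMap.id_comp]
  have h2 : φ ∘ₗ ψ = LinearMap.id := by
    apply (ha C).1
    refine hom_ext ?_
    change (φ ∘ₗ ψ).rTensor X.carrier ∘ₗ a.lin = LinearMap.id.rTensor X.carrier ∘ₗ a.lin
    rw [LinearMap.rTensor_comp, LinearMap.comp_assoc, hψ, hφ, LinearMap.rTensor_id,
      LinearMap.id_comp]
  -- Maps out of h(X, X) are determined by their composite with the unit, so both coalgebra
  -- identities are checked there.
  refine ⟨{ (LinearEquiv.ofLinearMap φ ψ h2 h1 : X.Coend ≃ₗ[R] C) with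
    counit_comp := ?_, map_comp_comul := ?_ }⟩
  · apply X.coend_hom_ext
    change (Coalgebra.counit (R := R) (A := C) ∘ₗ φ).rTensor X.carrier ∘ₗ X.coendUnit.lin =
      X.coendCounit.rTensor X.carrier ∘ₗ X.coendUnit.lin
    rw [LinearMap.rTensor_comp, LinearMap.comp_assoc, hφ, hε]
    exact (X.cohomDesc_unit (insert (1 : R) X)).symm
  · apply X.coend_hom_ext
    change (TensorProduct.map φ φ ∘ₗ X.coendComul).rTensor X.carrier ∘ₗ X.coendUnit.lin =
      (Coalgebra.comul (R := R) (A := C) ∘ₗ φ).rTensor X.carrier ∘ₗ X.coendUnit.lin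
    have h3 : X.coendComul.rTensor X.carrier ∘ₗ X.coendUnit.lin =
      (TensorProduct.assoc R X.Coend X.Coend X.carrier).symm.toLinearMap ∘ₗ
        X.coendUnit.lin.lTensor X.Coend ∘ₗ X.coendUnit.lin := X.cohomDesc_unit _
    rw [LinearMap.rTensor_comp, LinearMap.rTensor_comp, LinearMap.comp_assoc, h3,
      LinearMap.comp_assoc, hφ, hΔ, ← hφ]
    exact congrArg (· ∘ₗ X.coendUnit.lin) (map_rTensor_assoc_symm φ X.coendUnit.lin)

variable (E : RightComod R C ≌ RightComod R D) [E.functor.Additive] [E.functor.Linear R]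

/-- The functors `- ⊗ F(M)` and `F(- ⊗ M)` agree for a linear equivalence `F`. -/
noncomputable def tensorFunctorIso (M : RightComod R C) :
    (E.functor.obj M).tensorFunctor ≅ M.tensorFunctor ⋙ E.functor :=
  NatIso.ofComponents (fun W =>
      @asIso _ _ _ _ (comparison E.functor W M) (comparison_isIso E W M))
    fun g => comparison_natural_left E.functor g.hom M

/-- The functor `- ⊗ F(C)` is right adjoint to the inverse of `F` followed by the forgetful
functor. -/
noncomputable def imageAdj : E.inverse ⋙ forgetful R C ⊣
    (E.functor.obj (regular R C)).tensorFunctor :=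
  (E.symm.toAdjunction.comp (forgetfulAdj R C)).ofNatIsoRight (tensorFunctorIso E _).symm

theorem quasiFinite_image : (E.functor.obj (regular R C)).QuasiFinite :=
  (imageAdj E).isRightAdjoint

/-- The left adjoint is an equivalence followed by the forgetful functor, and both preserve
monomorphisms. -/
theorem injector_image [Module.Flat R C] : (E.functor.obj (regular R C)).Injector :=
  fun W _ => Injective.injective_of_adjoint (imageAdj E) W

/-- Up to λ, the map attached to g is F of the colinear map C ⟶ W ⊗ C that corresponds to g under
the cofree adjunction. Full faithfulness of F and invertibility of λ then give bijectivity. -/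
theorem imageCoact_universal (W : Type u) [AddCommGroup W] [Module R W] :
    Function.Bijective fun g : C →ₗ[R] W =>
      imageCoact E ≫ tensorMapLeft g (E.functor.obj (regular R C)) := by
  have h : ∀ g : C →ₗ[R] W, imageCoact E ≫ tensorMapLeft g (E.functor.obj (regular R C)) =
      E.functor.map (cofreeEquiv (regular R C) W g) ≫ inv (comparison E.functor W (regular R C)) :=
    fun g => by
      rw [← cancel_mono (comparison E.functor W (regular R C)), Category.assoc, Category.assoc,
        IsIso.inv_hom_id, Category.comp_id, comparison_natural_left, ← Category.assoc,
        imageCoact_comparison, ← E.functor.map_comp]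
      rfl
  simp only [h]
  have h1 : Function.Bijective fun f : E.functor.obj (regular R C) ⟶ E.functor.obj
      (tensor W (regular R C)) => f ≫ inv (comparison E.functor W (regular R C)) :=
    ((asIso (comparison E.functor W (regular R C))).symm.homToEquiv).bijective
  exact h1.comp ((Functor.FullyFaithful.ofFullyFaithful E.functor).map_bijective _ _ |>.comp
    (cofreeEquiv (regular R C) W).bijective)

theorem coend_image [(E.functor.obj (regular R C)).QuasiFinite] :
    Nonempty ((E.functor.obj (regular R C)).Coend ≃ₗc[R] C) :=
  coend_equiv_of_universal _ (imageCoact E) (fun W => imageCoact_universal E W)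
    (imageCoact_coassoc E) (imageCoact_counit E)

end Image
end RightComod

/-! ### F(M) as the cotensor product of M and F(C), and its purity -/

namespace RightComod

section Cotensor

variable {R : Type u} [CommRing R] {C D : Type u} [AddCommGroup C] [Module R C] [Coalgebra R C]
  [AddCommGroup D] [Module R D] [Coalgebra R D]

theorem injective_of_isIso {M N : RightComod R C} (f : M ⟶ N) [IsIso f] :
    Function.Injective f.lin :=
  Function.LeftInverse.injective (g := (inv f).lin) fun x =>
    LinearMap.congr_fun (congrArg Hom.lin (IsIso.hom_inv_id f)) x

variable (E : RightComod R C ≌ RightComod R D) [E.functor.Additive] [E.functor.Linear R]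

/-- The natural map `F(M) ⟶ M ⊗ F(C)` that identifies `F(M)` with the cotensor product of `M` and
`F(C)`. -/
noncomputable def theta (M : RightComod R C) :
    E.functor.obj M ⟶ tensor M.carrier (E.functor.obj (regular R C)) :=
  E.functor.map (coactHom M) ≫ inv (comparison E.functor M.carrier (regular R C))

theorem theta_comparison (M : RightComod R C) :
    theta E M ≫ comparison E.functor M.carrier (regular R C) = E.functor.map (coactHom M) := by
  rw [theta, Category.assoc, IsIso.inv_hom_id, Category.comp_id]

/-- Under the identification of F(M) with M □ F(C), the map F(f) becomes f □ F(C). -/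
theorem theta_naturality {M N : RightComod R C} (f : M ⟶ N) :
    E.functor.map f ≫ theta E N =
      theta E M ≫ tensorMapLeft f.lin (E.functor.obj (regular R C)) := by
  rw [← cancel_mono (comparison E.functor N.carrier (regular R C)), Category.assoc,
    Category.assoc, theta_comparison, comparison_natural_left, ← Category.assoc, theta_comparison,
    ← E.functor.map_comp, ← E.functor.map_comp, coactHom_naturality]

/-- The coaction of M is injective, and F preserves this. -/
theorem theta_injective [Module.Flat R C] [Module.Flat R D] (M : RightComod R C) :
    Function.Injective (theta E M).lin := by
  have h1 := injective_of_isEquivalence E.functor (coactHom M) (coact_injective M)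
  exact (injective_of_isIso (inv (comparison E.functor M.carrier (regular R C)))).comp h1

theorem tensorMapRight_comp (W : Type u) [AddCommGroup W] [Module R W] {L M N : RightComod R C}
    (f : L ⟶ M) (g : M ⟶ N) :
    tensorMapRight W (f ≫ g) = tensorMapRight W f ≫ tensorMapRight W g :=
  hom_ext (LinearMap.lTensor_comp W g.lin f.lin)

/-- Through λ, F of the map with kernel M becomes, up to an associator, the map that defines M □
F(C). This is where the left coaction on F(C), defined from F(Δ), enters. -/
theorem comparison_cobarDiff (M : RightComod R C) :
    comparison E.functor M.carrier (regular R C) ≫ E.functor.map (cobarDiff M) =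
      (tensorMapLeft M.coact (E.functor.obj (regular R C)) -
        tensorMapRight M.carrier (imageCoact E) ≫
          tensorAssocInv M.carrier C (E.functor.obj (regular R C))) ≫
        comparison E.functor (M.carrier ⊗[R] C) (regular R C) := by
  rw [cobarDiff, E.functor.map_sub, Preadditive.comp_sub, Preadditive.sub_comp,
    comparison_natural_left, Category.assoc, comparison_assoc, ← Category.assoc
    (tensorMapRight M.carrier (imageCoact E)), ← tensorMapRight_comp, imageCoact_comparison,
    ← Category.assoc, comparison_natural_right, E.functor.map_comp, Category.assoc]

/-- `F(M)` is the cotensor product of `M` and `F(C)`. -/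
theorem exact_theta [Module.Flat R C] [Module.Flat R D] (M : RightComod R C) :
    Function.Exact (theta E M).lin (cotensorDiff M (imageBicomod E).left) := by
  have h := exact_map E.functor (exact_coactHom M)
  have h1 := congrArg Hom.lin (comparison_cobarDiff E M)
  have h2 := congrArg Hom.lin (theta_comparison E M)
  have hi := injective_of_isIso (comparison E.functor M.carrier (regular R C))
  have hi' := injective_of_isIso (comparison E.functor (M.carrier ⊗[R] C) (regular R C))
  intro z
  have h3 : (tensorMapLeft M.coact (E.functor.obj (regular R C)) -
        tensorMapRight M.carrier (imageCoact E) ≫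
          tensorAssocInv M.carrier C (E.functor.obj (regular R C))).lin z =
      (TensorProduct.assoc R M.carrier C _).symm (cotensorDiff M (imageBicomod E).left z) := by
    refine Eq.trans ?_ (map_sub (TensorProduct.assoc R M.carrier C _).symm _ _).symm
    rw [sub_lin]
    exact (sub_left_inj.2 (LinearEquiv.symm_apply_apply (TensorProduct.assoc R M.carrier C _)
      (M.coact.rTensor _ z))).symm
  have h4 := LinearMap.congr_fun h1 z
  simp only [comp_lin, LinearMap.comp_apply] at h4
  -- Both vertical maps λ of the square are injective, so membership in the cotensor product can be
  -- tested after applying F to the cobar sequence.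
  have h5 : cotensorDiff M (imageBicomod E).left z = 0 ↔ (E.functor.map (cobarDiff M)).lin
      ((comparison E.functor M.carrier (regular R C)).lin z) = 0 := by
    refine Iff.trans ?_ (Iff.of_eq (congrArg (· = 0) h4)).symm
    rw [map_eq_zero_iff _ hi']
    exact ((Iff.of_eq (congrArg (· = 0) h3)).trans (LinearEquiv.map_eq_zero_iff _)).symm
  rw [h5]
  refine (h _).trans ?_
  constructor
  · rintro ⟨y, hy⟩
    exact ⟨y, hi ((LinearMap.congr_fun h2 y).trans hy)⟩
  · rintro ⟨y, rfl⟩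
    exact ⟨y, (LinearMap.congr_fun h2 y).symm⟩

/-- The coaction of W ⊗ M is the coaction of M tensored with W, and λ is compatible with iterated
tensor products. The purity of the cotensor product is derived from this identity. -/
theorem theta_tensor (W : Type u) [AddCommGroup W] [Module R W] (M : RightComod R C) :
    comparison E.functor W M ≫ theta E (tensor W M) =
      tensorMapRight W (theta E M) ≫
        tensorAssocInv W M.carrier (E.functor.obj (regular R C)) := by
  rw [← cancel_mono (comparison E.functor (W ⊗[R] M.carrier) (regular R C))]
  have h : coactHom (tensor W M) = tensorMapRight W (coactHom M) ≫
    tensorAssocInv W M.carrier (regular R C) := rfl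
  rw [Category.assoc, Category.assoc, theta_comparison, comparison_assoc, ← Category.assoc
    (tensorMapRight W _), ← tensorMapRight_comp, theta_comparison, ← Category.assoc
    (tensorMapRight W _), comparison_natural_right, Category.assoc, h, E.functor.map_comp]

theorem cotensorDiff_tensor (W : Type u) [AddCommGroup W] [Module R W] (M : RightComod R C)
    (N : LeftComod R C) (z : W ⊗[R] (M.carrier ⊗[R] N.carrier)) :
    cotensorDiff (tensor W M) N ((TensorProduct.assoc R W M.carrier N.carrier).symm z) =
      (TensorProduct.assoc R W M.carrier (C ⊗[R] N.carrier)).symm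
        ((cotensorDiff M N).lTensor W z) := by
  induction z with
  | zero => simp
  | add a b ha hb => simp only [map_add, ha, hb]
  | tmul w y =>
    induction y with
    | zero => simp
    | add a b ha hb => simp only [map_add, TensorProduct.tmul_add, ha, hb]
    | tmul m n =>
      simp only [cotensorDiff, LinearMap.sub_apply, LinearMap.comp_apply, LinearEquiv.coe_coe,
        LinearMap.lTensor_tmul, LinearMap.rTensor_tmul, TensorProduct.assoc_symm_tmul,
        Coact.right_tmul, TensorProduct.tmul_sub, map_sub]
      congr 1
      generalize M.coact m = y
      induction y <;> simp_all [TensorProduct.tmul_add, TensorProduct.add_tmul]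

/-- By `theta_tensor`, W ⊗ θ for M is, up to isomorphisms, θ for W ⊗ M. Hence W may be any module,
flat or not. -/
theorem lTensor_theta_injective [Module.Flat R C] [Module.Flat R D] (W : Type u) [AddCommGroup W]
    [Module R W] (M : RightComod R C) : Function.Injective ((theta E M).lin.lTensor W) := by
  have h := congrArg Hom.lin (theta_tensor E W M)
  have h1 : Function.Injective (comparison E.functor W M ≫ theta E (tensor W M)).lin :=
    (theta_injective E (tensor W M)).comp (injective_of_isIso (comparison E.functor W M))
  rw [h] at h1
  exact Function.Injective.of_comp h1

/-- Purity: W ⊗ (M □ F(C)) and (W ⊗ M) □ F(C) are both identified with F(W ⊗ M), so W ⊗ - preserves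
the kernel that defines M □ F(C). -/
theorem lTensor_exact_theta [Module.Flat R C] [Module.Flat R D] (W : Type u) [AddCommGroup W]
    [Module R W] (M : RightComod R C) : Function.Exact ((theta E M).lin.lTensor W)
      ((cotensorDiff M (imageBicomod E).left).lTensor W) := by
  have h := congrArg Hom.lin (theta_tensor E W M)
  have h' := LinearMap.congr_fun (congrArg Hom.lin (IsIso.inv_hom_id (comparison E.functor W M)))
  have he := exact_theta E (tensor W M)
  intro z
  have h1 : (cotensorDiff M (imageBicomod E).left).lTensor W z = 0 ↔
      cotensorDiff (tensor W M) (imageBicomod E).left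
        ((TensorProduct.assoc R W M.carrier _).symm z) = 0 := by
    refine Iff.trans ?_ (Iff.of_eq (congrArg (· = 0)
      (cotensorDiff_tensor W M (imageBicomod E).left z))).symm
    exact (LinearEquiv.map_eq_zero_iff _).symm
  rw [h1]
  refine (he _).trans ?_
  constructor
  · rintro ⟨y, hy⟩
    -- A preimage in F(W ⊗ M) is moved to W ⊗ F(M) by the inverse of λ.
    refine ⟨(inv (comparison E.functor W M)).lin y, ?_⟩
    apply (TensorProduct.assoc R W M.carrier _).symm.injective
    refine Eq.trans ?_ hy
    refine (LinearMap.congr_fun h _).symm.trans ?_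
    exact congrArg (theta E (tensor W M)).lin (h' y)
  · rintro ⟨y, rfl⟩
    exact ⟨(comparison E.functor W M).lin y, LinearMap.congr_fun h y⟩

/-- By θ, the functor - □ F(C) is F followed by the forgetful functor. Exactness is preserved
because F is an equivalence; faithfulness holds because F is faithful. -/
theorem image_left_coflat [Module.Flat R C] [Module.Flat R D] :
    (imageBicomod E).left.FaithfullyCoflat := by
  have hn : ∀ {M N : RightComod R C} (f : M ⟶ N) (y), (theta E N).lin ((E.functor.map f).lin y) =
      f.lin.rTensor _ ((theta E M).lin y) := fun f y =>
    LinearMap.congr_fun (congrArg Hom.lin (theta_naturality E f)) y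
  have hm : ∀ {M : RightComod R C} (y), (theta E M).lin y ∈ cotensor M (imageBicomod E).left :=
    fun {M} y => (exact_theta E M _).2 ⟨y, rfl⟩
  constructor
  · intro M₁ M₂ M₃ f g hfg
    have h := exact_map E.functor hfg
    rintro ⟨z, hz⟩
    obtain ⟨y, rfl⟩ := (exact_theta E M₂ z).1 hz
    constructor
    · intro h0
      have h1 : g.lin.rTensor _ ((theta E M₂).lin y) = 0 := congrArg Subtype.val h0
      rw [← hn, map_eq_zero_iff _ (theta_injective E M₃)] at h1
      obtain ⟨x, rfl⟩ := (h y).1 h1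
      -- The preimage is found in F(M₁) by exactness of the image sequence under F and carried into
      -- M₁ □ F(C) by θ.
      exact ⟨⟨_, hm x⟩, Subtype.ext (hn f x).symm⟩
    · rintro ⟨⟨t, ht⟩, htz⟩
      obtain ⟨x, rfl⟩ := (exact_theta E M₁ t).1 ht
      have h1 : f.lin.rTensor _ ((theta E M₁).lin x) = (theta E M₂).lin y :=
        congrArg Subtype.val htz
      rw [← hn] at h1
      have h2 := theta_injective E M₂ h1
      refine Subtype.ext ((hn g y).symm.trans ?_)
      rw [(h y).2 ⟨x, h2⟩, map_zero]
      rfl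
  · refine ⟨fun {M N} f g hfg => E.functor.map_injective (hom_ext (LinearMap.ext fun y => ?_))⟩
    apply theta_injective E N
    rw [hn, hn]
    have h := LinearMap.congr_fun (congrArg ModuleCat.Hom.hom hfg) ⟨_, hm y⟩
    exact congrArg Subtype.val h

/-- The functor - ⊗ F(C) is F(- ⊗ C) by λ; flatness of C and preservation of injectivity under F
give the claim. -/
theorem image_flat [Module.Flat R C] [Module.Flat R D] :
    Module.Flat R (E.functor.obj (regular R C)).carrier := by
  rw [Module.Flat.iff_rTensor_preserves_injective_linearMap]
  intro V W _ _ _ _ g hg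
  have h := congrArg Hom.lin (comparison_natural_left E.functor g (regular R C))
  have h1 := injective_of_isEquivalence E.functor (tensorMapLeft g (regular R C))
    (Module.Flat.rTensor_preserves_injective_linearMap (M := C) g hg)
  have h2 := h1.comp (injective_of_isIso (comparison E.functor V (regular R C)))
  refine Function.Injective.of_comp (f := (comparison E.functor W (regular R C)).lin) ?_
  have h3 : Function.Injective (comparison E.functor V (regular R C) ≫
    E.functor.map (tensorMapLeft g (regular R C))).lin := h2
  rw [← h] at h3
  exact h3

/-- The canonical map `D ⟶ G(D) ⊗ F(C)`. -/
noncomputable def beta : regular R D ⟶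
    tensor (E.inverse.obj (regular R D)).carrier (E.functor.obj (regular R C)) :=
  E.counitInv.app (regular R D) ≫ theta E (E.inverse.obj (regular R D))

/-- The isomorphism N ≅ FG(N) respects tensoring with modules, where FG carries the comparison map
composed from those of F and G. On each slice w ⊗ - this is naturality along m ↦ w ⊗ m. -/
theorem counitInv_tensor (W : Type u) [AddCommGroup W] [Module R W] (N : RightComod R D) :
    tensorMapRight W (E.counitInv.app N) ≫ comparison E.functor W (E.inverse.obj N) ≫
      E.functor.map (comparison E.symm.functor W N) = E.counitInv.app (tensor W N) := by
  refine tensor_hom_ext fun w => ?_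
  rw [← Category.assoc, insert_tensorMapRight, Category.assoc]
  change _ ≫ insert w (E.functor.obj (E.inverse.obj N)) ≫ _ = _
  rw [← Category.assoc (insert w _), insert_comparison, ← E.functor.map_comp]
  have h := insert_comparison E.symm.functor w N
  change insert w (E.inverse.obj N) ≫ _ = E.inverse.map (insert w N) at h
  rw [h]
  exact (E.counitInv.naturality (insert w N)).symm

/-- The map D → G(D) ⊗ F(C) is left D-colinear, where G(D) carries the left coaction obtained from
G(Δ). -/
theorem beta_comul :
    beta E ≫ tensorMapLeft (imageCoact E.symm).lin (E.functor.obj (regular R C)) =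
      regularComul R D ≫ tensorMapRight D (beta E) ≫ tensorAssocInv D _ _ := by
  -- After composition with F applied to the comparison map of G, this is naturality of the counit
  -- along Δ.
  have h : E.counitInv.app (regular R D) ≫ E.functor.map (imageCoact E.symm) =
      regularComul R D ≫ tensorMapRight D (E.counitInv.app (regular R D)) ≫
        comparison E.functor D (E.inverse.obj (regular R D)) := by
    have : IsIso (comparison E.symm.functor D (regular R D)) := comparison_isIso E.symm _ _
    rw [← cancel_mono (E.functor.map (comparison E.symm.functor D (regular R D)))]
    simp only [Category.assoc]
    rw [counitInv_tensor, ← E.functor.map_comp, imageCoact_comparison]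
    exact (E.counitInv.naturality (regularComul R D)).symm
  have h1 := theta_tensor E D (E.inverse.obj (regular R D))
  have h2 := theta_naturality E (imageCoact E.symm)
  rw [beta, tensorMapRight_comp, Category.assoc, Category.assoc, ← h1]
  exact (congrArg (E.counitInv.app (regular R D) ≫ ·) h2).symm.trans
    ((Category.assoc _ _ _).symm.trans ((congrArg (· ≫ theta E _) h).trans (by
      simp only [Category.assoc]; rfl)))

end Cotensor
end RightComod

/-! ### The identification of D with G(D) □ F(C) -/

/-- An isomorphism of the `D`-bicomodule `D` with the cotensor product of `Y` and `X`, compatible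
with tensor products with `R`-modules. -/
structure IsPureCotensor {R : Type u} [CommRing R] {C D : Type u} [AddCommGroup C] [Module R C]
    [Coalgebra R C] [AddCommGroup D] [Module R D] [Coalgebra R D] (X : Bicomod R C D)
    (Y : Bicomod R D C) (b : D →ₗ[R] Y.right.carrier ⊗[R] X.right.carrier) : Prop where
  injective : ∀ (W : Type u) [AddCommGroup W] [Module R W], Function.Injective (b.lTensor W)
  exact : ∀ (W : Type u) [AddCommGroup W] [Module R W],
    Function.Exact (b.lTensor W) ((cotensorDiff Y.right X.left).lTensor W)
  right : Coact.right Y.right.carrier X.right.coact ∘ₗ b = b.rTensor D ∘ₗ Coalgebra.comul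
  left : Coact.left Y.coactLeft X.right.carrier ∘ₗ b = b.lTensor D ∘ₗ Coalgebra.comul

/-- The map `beta` is the isomorphism D ≅ FG(D) followed by θ for M = G(D), so injectivity and
exactness after W ⊗ - come from θ. Right colinearity is built into `beta`; left colinearity is
`beta_comul`. -/
theorem isPureCotensor_image {R : Type u} [CommRing R] {C D : Type u} [AddCommGroup C]
    [Module R C] [Coalgebra R C] [AddCommGroup D] [Module R D] [Coalgebra R D] [Module.Flat R C]
    [Module.Flat R D] (E : RightComod R C ≌ RightComod R D) [E.functor.Additive]
    [E.functor.Linear R] :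
    IsPureCotensor (imageBicomod E) (imageBicomod E.symm) (RightComod.beta E).lin := by
  let e := E.counitIso.symm.app (RightComod.regular R D)
  let l : D ≃ₗ[R] (E.functor.obj (E.inverse.obj (RightComod.regular R D))).carrier :=
    LinearEquiv.ofLinearMap (RightComod.Hom.lin e.hom) (RightComod.Hom.lin e.inv)
      (congrArg RightComod.Hom.lin e.inv_hom_id) (congrArg RightComod.Hom.lin e.hom_inv_id)
  have hl : ∀ (W : Type u) [AddCommGroup W] [Module R W], (RightComod.beta E).lin.lTensor W =
      (RightComod.theta E (E.inverse.obj (RightComod.regular R D))).lin.lTensor W ∘ₗ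
        (l.lTensor W).toLinearMap := fun W _ _ => LinearMap.lTensor_comp W _ _
  refine ⟨fun W _ _ => ?_, fun W _ _ => ?_, (RightComod.beta E).colinear, ?_⟩
  · exact (congrArg (fun f : _ →ₗ[R] _ => Function.Injective f) (hl W)).mpr <|
      (RightComod.lTensor_theta_injective E W _).comp (l.lTensor W).injective
  · refine (congrArg (fun f : _ →ₗ[R] _ => Function.Exact f _) (hl W)).mpr fun z => ?_
    refine (RightComod.lTensor_exact_theta E W _ z).trans ?_
    constructor
    · rintro ⟨y, rfl⟩
      exact ⟨(l.lTensor W).symm y, congrArg _ ((l.lTensor W).apply_symm_apply y)⟩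
    · rintro ⟨y, rfl⟩
      exact ⟨l.lTensor W y, rfl⟩
  · have h := congrArg RightComod.Hom.lin (RightComod.beta_comul E)
    exact LinearMap.ext fun x => (congrArg (TensorProduct.assoc R D _ _)
      (LinearMap.congr_fun h x)).trans (LinearEquiv.apply_symm_apply _ _)

/-! ### Associativity of the conditions that define cotensor products -/

section CoactAssoc

variable {R : Type u} [CommRing R] {C D : Type u} [AddCommGroup C] [Module R C]
  [AddCommGroup D] [Module R D]

theorem LinearMap.rTensor_exact_of_lTensor_exact {M N P W : Type u} [AddCommGroup M] [Module R M]
    [AddCommGroup N] [Module R N] [AddCommGroup P] [Module R P] [AddCommGroup W] [Module R W]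
    {f : M →ₗ[R] N} {g : N →ₗ[R] P} (h : Function.Exact (f.lTensor W) (g.lTensor W)) :
    Function.Exact (f.rTensor W) (g.rTensor W) := by
  have hf : ∀ y, f.rTensor W (TensorProduct.comm R W M y) =
      TensorProduct.comm R W N (f.lTensor W y) := LinearMap.congr_fun
    (f := f.rTensor W ∘ₗ (TensorProduct.comm R W M).toLinearMap)
    (g := (TensorProduct.comm R W N).toLinearMap ∘ₗ f.lTensor W) (TensorProduct.ext' fun _ _ => rfl)
  have hg : ∀ y, g.rTensor W (TensorProduct.comm R W N y) =
      TensorProduct.comm R W P (g.lTensor W y) := LinearMap.congr_fun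
    (f := g.rTensor W ∘ₗ (TensorProduct.comm R W N).toLinearMap)
    (g := (TensorProduct.comm R W P).toLinearMap ∘ₗ g.lTensor W) (TensorProduct.ext' fun _ _ => rfl)
  intro z
  obtain ⟨z, rfl⟩ := (TensorProduct.comm R W N).surjective z
  rw [hg, LinearEquiv.map_eq_zero_iff, h z]
  constructor
  · rintro ⟨y, rfl⟩
    exact ⟨_, hf y⟩
  · rintro ⟨y, hy⟩
    obtain ⟨y, rfl⟩ := (TensorProduct.comm R W M).surjective y
    exact ⟨y, (TensorProduct.comm R W N).injective ((hf y).symm.trans hy)⟩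

/-- The condition for M □ (P ⊗ N) is the condition for M □ P tensored with N. Purity of M □ P thus
describes its solutions as (M □ P) ⊗ N. -/
theorem Coact.left_diff_assoc {M P N : Type u} [AddCommGroup M] [Module R M] [AddCommGroup N]
    [Module R N] [AddCommGroup P] [Module R P] (ρ : M →ₗ[R] M ⊗[R] C) (σ : P →ₗ[R] C ⊗[R] P)
    (z : (M ⊗[R] P) ⊗[R] N) :
    ((TensorProduct.assoc R M C (P ⊗[R] N)).toLinearMap ∘ₗ ρ.rTensor (P ⊗[R] N) -
        (Coact.left σ N).lTensor M) (TensorProduct.assoc R M P N z) =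
      (TensorProduct.assoc R C P N).toLinearMap.lTensor M
        (TensorProduct.assoc R M (C ⊗[R] P) N
          (((TensorProduct.assoc R M C P).toLinearMap ∘ₗ ρ.rTensor P -
            σ.lTensor M).rTensor N z)) := by
  have h1 : (TensorProduct.assoc R M C (P ⊗[R] N)).toLinearMap ∘ₗ ρ.rTensor (P ⊗[R] N) ∘ₗ
      (TensorProduct.assoc R M P N).toLinearMap =
      (TensorProduct.assoc R C P N).toLinearMap.lTensor M ∘ₗ
        (TensorProduct.assoc R M (C ⊗[R] P) N).toLinearMap ∘ₗ
          ((TensorProduct.assoc R M C P).toLinearMap ∘ₗ ρ.rTensor P).rTensor N := by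
    refine TensorProduct.ext_threefold fun m p n => ?_
    simp only [LinearMap.comp_apply, LinearEquiv.coe_coe, TensorProduct.assoc_tmul,
      LinearMap.rTensor_tmul]
    generalize ρ m = y
    induction y <;> simp_all [TensorProduct.add_tmul]
  have h2 : (Coact.left σ N).lTensor M ∘ₗ (TensorProduct.assoc R M P N).toLinearMap =
      (TensorProduct.assoc R C P N).toLinearMap.lTensor M ∘ₗ
        (TensorProduct.assoc R M (C ⊗[R] P) N).toLinearMap ∘ₗ (σ.lTensor M).rTensor N :=
    TensorProduct.ext_threefold fun m p n => rfl
  rw [LinearMap.rTensor_sub, LinearMap.sub_apply, LinearMap.sub_apply, map_sub, map_sub]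
  exact congrArg₂ _ (LinearMap.congr_fun h1 z) (LinearMap.congr_fun h2 z)

/-- Right colinearity of b pulls the condition for X □ N, tensored with Y, back along b to the
condition for D □ N. -/
theorem Coact.right_diff_assoc {X Y N : Type u} [AddCommGroup X] [Module R X] [AddCommGroup N]
    [Module R N] [AddCommGroup Y] [Module R Y] (ρ : X →ₗ[R] X ⊗[R] D) (σ : N →ₗ[R] D ⊗[R] N)
    (b : D →ₗ[R] Y ⊗[R] X) (Δ : D →ₗ[R] D ⊗[R] D)
    (hb : Coact.right Y ρ ∘ₗ b = b.rTensor D ∘ₗ Δ) (w : D ⊗[R] N) :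
    ((TensorProduct.assoc R X D N).toLinearMap ∘ₗ ρ.rTensor N - σ.lTensor X).lTensor Y
        (TensorProduct.assoc R Y X N (b.rTensor N w)) =
      TensorProduct.assoc R Y X (D ⊗[R] N) (b.rTensor (D ⊗[R] N)
        (((TensorProduct.assoc R D D N).toLinearMap ∘ₗ Δ.rTensor N - σ.lTensor D) w)) := by
  rw [LinearMap.lTensor_sub, LinearMap.sub_apply, LinearMap.sub_apply, map_sub, map_sub]
  congr 1
  · induction w with
    | zero => simp
    | add x y hx hy => simp only [map_add, hx, hy]
    | tmul d n =>
      have h1 : ∀ t : Y ⊗[R] X,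
          ((TensorProduct.assoc R X D N).toLinearMap ∘ₗ ρ.rTensor N).lTensor Y
            (TensorProduct.assoc R Y X N (t ⊗ₜ n)) =
          TensorProduct.assoc R Y X (D ⊗[R] N) (TensorProduct.assoc R (Y ⊗[R] X) D N
            (Coact.right Y ρ t ⊗ₜ n)) := by
        intro t
        induction t with
        | zero => simp
        | add x y hx hy => simp only [map_add, TensorProduct.add_tmul, hx, hy]
        | tmul y x =>
          simp only [Coact.right_tmul, TensorProduct.assoc_tmul, LinearMap.lTensor_tmul,
            LinearMap.comp_apply, LinearMap.rTensor_tmul, LinearEquiv.coe_coe]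
          generalize ρ x = u
          induction u <;> simp_all [TensorProduct.add_tmul, TensorProduct.tmul_add]
      have h2 : ∀ t : D ⊗[R] D,
          b.rTensor (D ⊗[R] N) (TensorProduct.assoc R D D N (t ⊗ₜ n)) =
            TensorProduct.assoc R (Y ⊗[R] X) D N (b.rTensor D t ⊗ₜ n) := by
        intro t
        induction t <;> simp_all [TensorProduct.add_tmul]
      simp only [LinearMap.rTensor_tmul, LinearMap.comp_apply, LinearEquiv.coe_coe]
      refine (h1 (b d)).trans ?_
      rw [h2, ← LinearMap.comp_apply, hb, LinearMap.comp_apply]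
  · induction w with
    | zero => simp
    | add x y hx hy => simp only [map_add, hx, hy]
    | tmul d n =>
      simp only [LinearMap.rTensor_tmul, LinearMap.lTensor_tmul]
      generalize b d = u
      induction u <;> simp_all [TensorProduct.add_tmul]

end CoactAssoc

/-! ### The equivalence X □ - between categories of left comodules -/

section CotensorEquivalence

variable {R : Type u} [CommRing R] {C D : Type u} [AddCommGroup C] [Module R C] [Coalgebra R C]
  [AddCommGroup D] [Module R D] [Coalgebra R D]

namespace LeftComod

/-- A linear map that becomes colinear after composition with an injective colinear map. -/
def homOfComp [Module.Flat R C] {K M N : LeftComod R C} (i : K ⟶ N)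
    (hi : Function.Injective i.lin) (f : M ⟶ N) (l : M.carrier →ₗ[R] K.carrier)
    (h : i.lin ∘ₗ l = f.lin) : M ⟶ K where
  lin := l
  colinear := by
    have hinj : Function.Injective (i.lin.lTensor C) :=
      Module.Flat.lTensor_preserves_injective_linearMap i.lin hi
    refine LinearMap.ext fun k => hinj ?_
    rw [← LinearMap.comp_apply, ← LinearMap.comp_assoc, ← i.colinear, LinearMap.comp_assoc, h,
      ← LinearMap.comp_apply (i.lin.lTensor C), ← LinearMap.comp_assoc, ← LinearMap.lTensor_comp,
      h, f.colinear]

/-- Two comodules embedded with the same image are isomorphic. -/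
noncomputable def isoOfRangeEq [Module.Flat R C] {M N T : LeftComod R C} (f : M ⟶ T) (g : N ⟶ T)
    (hf : Function.Injective f.lin) (hg : Function.Injective g.lin)
    (h : LinearMap.range f.lin = LinearMap.range g.lin) : M ≅ N where
  hom := lift g hg f fun x => h ▸ ⟨x, rfl⟩
  inv := lift f hf g fun x => h ▸ ⟨x, rfl⟩
  hom_inv_id := by
    have := mono_of_injective f hf
    rw [← cancel_mono f, Category.assoc, lift_comp, lift_comp, Category.id_comp]
  inv_hom_id := by
    have := mono_of_injective g hg
    rw [← cancel_mono g, Category.assoc, lift_comp, lift_comp, Category.id_comp]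

theorem isoOfRangeEq_hom_comp [Module.Flat R C] {M N T : LeftComod R C} (f : M ⟶ T) (g : N ⟶ T)
    (hf : Function.Injective f.lin) (hg : Function.Injective g.lin)
    (h : LinearMap.range f.lin = LinearMap.range g.lin) :
    (isoOfRangeEq f g hf hg h).hom ≫ g = f :=
  lift_comp _ _ _ _

end LeftComod

namespace Bicomod

open LeftComod

variable (X : Bicomod R C D)

/-- The right coaction of a bicomodule as a left colinear map. -/
def coactRight : X.left ⟶ tensor X.left D where
  lin := X.right.coact
  colinear := LinearMap.ext fun x => (congrArg (TensorProduct.assoc R C X.right.carrier D)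
    (LinearMap.congr_fun X.colinear x)).symm.trans (LinearEquiv.apply_symm_apply _ _)

/-- The map `x ⊗ n ↦ ϱ(x) ⊗ n` as a left colinear map. -/
def coactRightTensor (W : Type u) [AddCommGroup W] [Module R W] :
    tensor X.left W ⟶ tensor X.left (D ⊗[R] W) :=
  tensorMapLeft X.coactRight W ≫ tensorAssoc X.left D W

/-- The map that defines the cotensor product, as a left colinear map. -/
def cotensorDiffHom (N : LeftComod R D) :
    tensor X.left N.carrier ⟶ tensor X.left (D ⊗[R] N.carrier) where
  lin := cotensorDiff X.right N
  colinear := by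
    -- Both terms of the difference are left C-colinear, the first because the two coactions of a
    -- bicomodule commute.
    have h1 := (X.coactRightTensor N.carrier).colinear
    have h2 := (tensorMapRight X.left N.coact).colinear
    exact ((LinearMap.comp_sub _ _ _).trans (congrArg₂ (· - ·) h1 h2)).trans
      ((LinearMap.sub_comp _ _ _).symm.trans
        (congrArg (· ∘ₗ _) (LinearMap.lTensor_sub (M := C) _ _).symm))

variable [Module.Flat R C]

/-- The cotensor product `X □ N` as a left comodule. -/
noncomputable def cotensorLeft (N : LeftComod R D) : LeftComod R C :=
  ker (X.cotensorDiffHom N)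

/-- The inclusion of `X □ N` in `X ⊗ N`. -/
noncomputable def cotensorLeftι (N : LeftComod R D) :
    X.cotensorLeft N ⟶ tensor X.left N.carrier :=
  kerι _

theorem cotensorLeftι_injective (N : LeftComod R D) :
    Function.Injective (X.cotensorLeftι N).lin :=
  Submodule.subtype_injective _

/-- The functor `X □ -` from left `D`-comodules to left `C`-comodules. -/
noncomputable def cotensorLeftFunctor : LeftComod R D ⥤ LeftComod R C where
  obj N := X.cotensorLeft N
  map {M N} g := homOfComp (X.cotensorLeftι N) (X.cotensorLeftι_injective N)
    (X.cotensorLeftι M ≫ tensorMapRight X.left g.lin) (cotensorMap (𝟙 X.right) g) rfl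
  map_id N := hom_ext (cotensorMap_id X.right N)
  map_comp f g := hom_ext (cotensorMap_comp (𝟙 X.right) (𝟙 X.right) f g)

theorem cotensorLeftFunctor_map_comp {M N : LeftComod R D} (g : M ⟶ N) :
    X.cotensorLeftFunctor.map g ≫ X.cotensorLeftι N =
      X.cotensorLeftι M ≫ tensorMapRight X.left g.lin := rfl

end Bicomod

namespace IsPureCotensor

open LeftComod

variable {X : Bicomod R C D} {Y : Bicomod R D C}
  {b : D →ₗ[R] Y.right.carrier ⊗[R] X.right.carrier}

theorem rTensor_injective (h : IsPureCotensor X Y b) (W : Type u) [AddCommGroup W]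
    [Module R W] : Function.Injective (b.rTensor W) := by
  rw [← LinearMap.lTensor_inj_iff_rTensor_inj]
  exact h.injective W

theorem rTensor_exact (h : IsPureCotensor X Y b) (W : Type u) [AddCommGroup W] [Module R W] :
    Function.Exact (b.rTensor W) ((cotensorDiff Y.right X.left).rTensor W) :=
  LinearMap.rTensor_exact_of_lTensor_exact (h.exact W)

/-- The coaction of `N` followed by `b`, as a colinear map `N ⟶ Y ⊗ X ⊗ N`. -/
def embedding (h : IsPureCotensor X Y b) (N : LeftComod R D) :
    N ⟶ tensor Y.left (X.right.carrier ⊗[R] N.carrier) :=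
  coactHom N ≫ tensorMapLeft
    (show regular R D ⟶ tensor Y.left X.right.carrier from ⟨b, h.left⟩) N.carrier ≫
      tensorAssoc Y.left X.right.carrier N.carrier

theorem embedding_apply (h : IsPureCotensor X Y b) (N : LeftComod R D) (n : N.carrier) :
    (h.embedding N).lin n = TensorProduct.assoc R Y.right.carrier X.right.carrier N.carrier
      (b.rTensor N.carrier (N.coact n)) := rfl

theorem embedding_injective (h : IsPureCotensor X Y b) (N : LeftComod R D) :
    Function.Injective (h.embedding N).lin :=
  (TensorProduct.assoc R Y.right.carrier X.right.carrier N.carrier).injective.comp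
    ((h.rTensor_injective _).comp N.coact_injective)

theorem embedding_naturality (h : IsPureCotensor X Y b) {M N : LeftComod R D} (g : M ⟶ N) :
    g ≫ h.embedding N = h.embedding M ≫ tensorMapRight Y.left (g.lin.lTensor _) := by
  refine hom_ext (LinearMap.ext fun m => ?_)
  have hg := LinearMap.congr_fun g.colinear m
  change TensorProduct.assoc R Y.right.carrier X.right.carrier N.carrier
      (b.rTensor N.carrier (N.coact (g.lin m))) = (g.lin.lTensor _).lTensor _
        (TensorProduct.assoc R Y.right.carrier X.right.carrier M.carrier
          (b.rTensor M.carrier (M.coact m)))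
  rw [LinearMap.comp_apply] at hg
  rw [hg, LinearMap.comp_apply]
  generalize M.coact m = z
  induction z with
  | zero => simp
  | add x y hx hy => simp only [map_add, hx, hy]
  | tmul d m =>
    simp only [LinearMap.lTensor_tmul, LinearMap.rTensor_tmul]
    generalize b d = y
    induction y <;> simp_all [TensorProduct.add_tmul]

theorem cotensorDiff_left_assoc (N : LeftComod R D)
    (z : (Y.right.carrier ⊗[R] X.right.carrier) ⊗[R] N.carrier) :
    cotensorDiff Y.right (tensor X.left N.carrier)
      (TensorProduct.assoc R Y.right.carrier X.right.carrier N.carrier z) =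
      (TensorProduct.assoc R C X.right.carrier N.carrier).toLinearMap.lTensor _
        (TensorProduct.assoc R Y.right.carrier (C ⊗[R] X.right.carrier) N.carrier
          ((cotensorDiff Y.right X.left).rTensor N.carrier z)) :=
  Coact.left_diff_assoc Y.right.coact X.left.coact z

theorem cotensorDiff_right_assoc (h : IsPureCotensor X Y b) (N : LeftComod R D)
    (w : D ⊗[R] N.carrier) :
    (cotensorDiff X.right N).lTensor Y.right.carrier
      (TensorProduct.assoc R Y.right.carrier X.right.carrier N.carrier
        (b.rTensor N.carrier w)) =
      TensorProduct.assoc R Y.right.carrier X.right.carrier (D ⊗[R] N.carrier)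
        (b.rTensor (D ⊗[R] N.carrier) (cotensorDiff (RightComod.regular R D) N w)) :=
  Coact.right_diff_assoc X.right.coact N.coact b Coalgebra.comul h.right w

variable [Module.Flat R C] [Module.Flat R D]

/-- The inclusion `Y □ (X □ N) ⟶ Y ⊗ X ⊗ N`. -/
noncomputable def doubleι (X : Bicomod R C D) (Y : Bicomod R D C) (N : LeftComod R D) :
    Y.cotensorLeft (X.cotensorLeft N) ⟶ tensor Y.left (X.right.carrier ⊗[R] N.carrier) :=
  Y.cotensorLeftι (X.cotensorLeft N) ≫ tensorMapRight Y.left (X.cotensorLeftι N).lin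

theorem doubleι_naturality {M N : LeftComod R D} (g : M ⟶ N) :
    Y.cotensorLeftFunctor.map (X.cotensorLeftFunctor.map g) ≫ doubleι X Y N =
      doubleι X Y M ≫ tensorMapRight Y.left (g.lin.lTensor _) := by
  have h : (X.cotensorLeftι N).lin.lTensor Y.right.carrier ∘ₗ
      (X.cotensorLeftFunctor.map g).lin.lTensor Y.right.carrier =
      (g.lin.lTensor X.right.carrier).lTensor Y.right.carrier ∘ₗ
        (X.cotensorLeftι M).lin.lTensor Y.right.carrier :=
    TensorProduct.ext' fun _ _ => rfl
  exact hom_ext (LinearMap.ext fun t => LinearMap.congr_fun h t.1)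

variable [Module.Flat R Y.right.carrier]

/-- Flatness of Y keeps Y ⊗ (X □ N) inside Y ⊗ X ⊗ N. -/
theorem doubleι_injective (N : LeftComod R D) : Function.Injective (doubleι X Y N).lin :=
  (Module.Flat.lTensor_preserves_injective_linearMap (M := Y.right.carrier) _
    (X.cotensorLeftι_injective N)).comp (Y.cotensorLeftι_injective _)

/-- Since Y is flat, Y ⊗ (X □ N) is the kernel cut out by the first condition. The second is the
cotensor condition over C, which may be tested in the larger module because C and Y are flat. -/
theorem mem_range_doubleι (N : LeftComod R D)
    (z : Y.right.carrier ⊗[R] (X.right.carrier ⊗[R] N.carrier)) :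
    z ∈ LinearMap.range (doubleι X Y N).lin ↔
      (cotensorDiff X.right N).lTensor Y.right.carrier z = 0 ∧
        cotensorDiff Y.right (tensor X.left N.carrier) z = 0 := by
  have hK := Module.Flat.lTensor_exact Y.right.carrier
    ((X.cotensorDiffHom N).lin.exact_subtype_ker_map)
  have hi : Function.Injective (((X.cotensorLeftι N).lin.lTensor C).lTensor Y.right.carrier) :=
    Module.Flat.lTensor_preserves_injective_linearMap _
      (Module.Flat.lTensor_preserves_injective_linearMap _ (X.cotensorLeftι_injective N))
  have hd : ∀ t : Y.right.carrier ⊗[R] (X.cotensorLeft N).carrier,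
      cotensorDiff Y.right (tensor X.left N.carrier)
        ((X.cotensorLeftι N).lin.lTensor Y.right.carrier t) =
      ((X.cotensorLeftι N).lin.lTensor C).lTensor Y.right.carrier
        (cotensorDiff Y.right (X.cotensorLeft N) t) := fun t =>
    cotensorDiff_map (𝟙 Y.right) (X.cotensorLeftι N) t
  constructor
  · rintro ⟨⟨t, ht⟩, rfl⟩
    refine ⟨(hK _).2 ⟨t, rfl⟩, (hd t).trans ?_⟩
    exact (congrArg _ ht).trans (map_zero _)
  · rintro ⟨h1, h2⟩
    obtain ⟨t, rfl⟩ := (hK z).1 h1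
    have h3 := (hd t).symm.trans h2
    exact ⟨⟨t, (map_eq_zero_iff _ hi).1 h3⟩, rfl⟩

/-- This is associativity of the cotensor product combined with Y □ X ≅ D and D □ N ≅ N. By purity
the condition over C says that z comes from some w in D ⊗ N along b ⊗ N. Right colinearity and
injectivity of b ⊗ (D ⊗ N) turn the condition over D into w ∈ D □ N, that is, w = ϱ(n). -/
theorem range_embedding (h : IsPureCotensor X Y b) (N : LeftComod R D) :
    LinearMap.range (h.embedding N).lin = LinearMap.range (doubleι X Y N).lin := by
  ext z
  refine Iff.trans ?_ (mem_range_doubleι N z).symm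
  obtain ⟨z, rfl⟩ := (TensorProduct.assoc R Y.right.carrier X.right.carrier N.carrier).surjective z
  have hi : Function.Injective ((TensorProduct.assoc R C X.right.carrier
      N.carrier).toLinearMap.lTensor Y.right.carrier) :=
    (LinearEquiv.lTensor Y.right.carrier
      (TensorProduct.assoc R C X.right.carrier N.carrier)).injective
  have h0 : cotensorDiff Y.right (tensor X.left N.carrier)
      (TensorProduct.assoc R Y.right.carrier X.right.carrier N.carrier z) = 0 ↔
        (cotensorDiff Y.right X.left).rTensor N.carrier z = 0 :=
    (Iff.of_eq (congrArg (· = 0) (cotensorDiff_left_assoc N z))).trans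
      ((map_eq_zero_iff _ hi).trans (LinearEquiv.map_eq_zero_iff _))
  have hr : ∀ w, (cotensorDiff X.right N).lTensor Y.right.carrier
      (TensorProduct.assoc R Y.right.carrier X.right.carrier N.carrier
        (b.rTensor N.carrier w)) = 0 ↔ cotensorDiff (RightComod.regular R D) N w = 0 := fun w =>
    (Iff.of_eq (congrArg (· = 0) (h.cotensorDiff_right_assoc N w))).trans
      ((LinearEquiv.map_eq_zero_iff _).trans
        (map_eq_zero_iff _ (h.rTensor_injective (D ⊗[R] N.carrier))))
  refine Iff.trans ?_ (and_congr_right fun _ => h0).symm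
  constructor
  · rintro ⟨n, hn⟩
    have hz := (TensorProduct.assoc R Y.right.carrier X.right.carrier N.carrier).injective
      ((h.embedding_apply N n).symm.trans hn)
    rw [← hz]
    exact ⟨(hr _).2 ((N.exact_coact _).2 ⟨n, rfl⟩), (h.rTensor_exact _ _).2 ⟨_, rfl⟩⟩
  · rintro ⟨h1, h2⟩
    obtain ⟨w, rfl⟩ := (h.rTensor_exact _ z).1 h2
    obtain ⟨n, rfl⟩ := (N.exact_coact w).1 ((hr w).1 h1)
    exact ⟨n, rfl⟩

/-- Every left `D`-comodule `N` is isomorphic to `Y □ (X □ N)`. -/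
noncomputable def cotensorIsoApp (h : IsPureCotensor X Y b) (N : LeftComod R D) :
    N ≅ Y.cotensorLeft (X.cotensorLeft N) :=
  isoOfRangeEq (h.embedding N) (doubleι X Y N) (h.embedding_injective N) (doubleι_injective N)
    (h.range_embedding N)

theorem cotensorIsoApp_comp (h : IsPureCotensor X Y b) (N : LeftComod R D) :
    (h.cotensorIsoApp N).hom ≫ doubleι X Y N = h.embedding N :=
  isoOfRangeEq_hom_comp _ _ _ _ _

theorem cotensorIsoApp_naturality (h : IsPureCotensor X Y b) {M N : LeftComod R D} (g : M ⟶ N) :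
    g ≫ (h.cotensorIsoApp N).hom = (h.cotensorIsoApp M).hom ≫
      (show Y.cotensorLeft (X.cotensorLeft M) ⟶ Y.cotensorLeft (X.cotensorLeft N) from
        Y.cotensorLeftFunctor.map (X.cotensorLeftFunctor.map g)) := by
  have := mono_of_injective _ (doubleι_injective (X := X) (Y := Y) N)
  rw [← cancel_mono (doubleι X Y N), Category.assoc, Category.assoc, cotensorIsoApp_comp]
  refine Eq.trans ?_ (congrArg (_ ≫ ·) (doubleι_naturality g)).symm
  exact (h.embedding_naturality g).trans ((congrArg (· ≫ _) (h.cotensorIsoApp_comp M).symm).trans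
    (Category.assoc _ _ _))

/-- The functors `X □ -` and `Y □ -` compose to the identity. -/
noncomputable def cotensorIso (h : IsPureCotensor X Y b) :
    𝟭 (LeftComod R D) ≅ X.cotensorLeftFunctor ⋙ Y.cotensorLeftFunctor :=
  NatIso.ofComponents h.cotensorIsoApp h.cotensorIsoApp_naturality

/-- The equivalence `X □ -` of categories of left comodules. -/
noncomputable def equivalence [Module.Flat R X.right.carrier] (h : IsPureCotensor X Y b)
    {a : C →ₗ[R] X.right.carrier ⊗[R] Y.right.carrier} (h' : IsPureCotensor Y X a) :
    LeftComod R D ≌ LeftComod R C :=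
  CategoryTheory.Equivalence.mk X.cotensorLeftFunctor Y.cotensorLeftFunctor h.cotensorIso
    h'.cotensorIso.symm

end IsPureCotensor

end CotensorEquivalence

/-! ### Recognition of the coendomorphism coalgebra of a left comodule -/

namespace LeftComod

section Coend

variable {R : Type u} [CommRing R] {C D : Type u} [AddCommGroup C] [Module R C] [Coalgebra R C]
  [AddCommGroup D] [Module R D] [Coalgebra R D]

theorem map_lTensor_assoc {V W M N : Type u} [AddCommGroup V] [Module R V] [AddCommGroup W]
    [Module R W] [AddCommGroup M] [Module R M] [AddCommGroup N] [Module R N] (φ : V →ₗ[R] W)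
    (η : M →ₗ[R] N ⊗[R] V) :
    (TensorProduct.map φ φ).lTensor N ∘ₗ (TensorProduct.assoc R N V V).toLinearMap ∘ₗ
        η.rTensor V =
      (TensorProduct.assoc R N W W).toLinearMap ∘ₗ (φ.lTensor N ∘ₗ η).rTensor W ∘ₗ
        φ.lTensor M := by
  refine TensorProduct.ext' fun m v => ?_
  simp only [LinearMap.lTensor_tmul, LinearMap.rTensor_tmul, LinearMap.comp_apply,
    LinearEquiv.coe_coe]
  generalize η m = y
  induction y <;> simp_all [TensorProduct.add_tmul]

/-- A coalgebra `V` with a coassociative and counital universal map `X ⟶ X ⊗ V` is isomorphic to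
the coendomorphism coalgebra of `X`. -/
theorem coend_equiv_of_universal (X : LeftComod R C) [X.QuasiFinite] (a : X ⟶ tensor X D)
    (ha : ∀ (W : Type u) [AddCommGroup W] [Module R W],
      Function.Bijective fun g : D →ₗ[R] W => a ≫ tensorMapRight X g)
    (hΔ : a ≫ tensorMapRight X Coalgebra.comul = a ≫ tensorMapLeft a D ≫ tensorAssoc X D D)
    (hε : a ≫ tensorMapRight X Coalgebra.counit = insert X (1 : R)) :
    Nonempty (X.Coend ≃ₗc[R] D) := by
  -- As on the right side, two universal elements for W ↦ Hom(X, X ⊗ W) determine mutually inverse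
  -- maps.
  let φ : X.Coend →ₗ[R] D := X.cohomDesc a
  have hφ : φ.lTensor X.carrier ∘ₗ X.coendUnit.lin = a.lin := X.cohomDesc_unit a
  obtain ⟨ψ, hψ⟩ := (ha X.Coend).2 X.coendUnit
  replace hψ : ψ.lTensor X.carrier ∘ₗ a.lin = X.coendUnit.lin := congrArg Hom.lin hψ
  replace hΔ : (Coalgebra.comul (R := R) (A := D)).lTensor X.carrier ∘ₗ a.lin =
    (TensorProduct.assoc R X.carrier D D).toLinearMap ∘ₗ a.lin.rTensor D ∘ₗ a.lin :=
    congrArg Hom.lin hΔ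
  replace hε : (Coalgebra.counit (R := R) (A := D)).lTensor X.carrier ∘ₗ a.lin =
    (TensorProduct.mk R X.carrier R).flip 1 := congrArg Hom.lin hε
  have h1 : ψ ∘ₗ φ = LinearMap.id := by
    apply X.coend_hom_ext
    rw [LinearMap.lTensor_comp, LinearMap.comp_assoc, hφ, hψ, LinearMap.lTensor_id,
      LinearMap.id_comp]
  have h2 : φ ∘ₗ ψ = LinearMap.id := by
    apply (ha D).1
    refine hom_ext ?_
    change (φ ∘ₗ ψ).lTensor X.carrier ∘ₗ a.lin = LinearMap.id.lTensor X.carrier ∘ₗ a.lin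
    rw [LinearMap.lTensor_comp, LinearMap.comp_assoc, hψ, hφ, LinearMap.lTensor_id,
      LinearMap.id_comp]
  refine ⟨{ (LinearEquiv.ofLinearMap φ ψ h2 h1 : X.Coend ≃ₗ[R] D) with
    counit_comp := ?_, map_comp_comul := ?_ }⟩
  · apply X.coend_hom_ext
    change (Coalgebra.counit (R := R) (A := D) ∘ₗ φ).lTensor X.carrier ∘ₗ X.coendUnit.lin =
      X.coendCounit.lTensor X.carrier ∘ₗ X.coendUnit.lin
    rw [LinearMap.lTensor_comp, LinearMap.comp_assoc, hφ, hε]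
    exact (X.cohomDesc_unit (insert X (1 : R))).symm
  · apply X.coend_hom_ext
    change (TensorProduct.map φ φ ∘ₗ X.coendComul).lTensor X.carrier ∘ₗ X.coendUnit.lin =
      (Coalgebra.comul (R := R) (A := D) ∘ₗ φ).lTensor X.carrier ∘ₗ X.coendUnit.lin
    have h3 : X.coendComul.lTensor X.carrier ∘ₗ X.coendUnit.lin =
      (TensorProduct.assoc R X.carrier X.Coend X.Coend).toLinearMap ∘ₗ
        X.coendUnit.lin.rTensor X.Coend ∘ₗ X.coendUnit.lin := X.cohomDesc_unit _
    rw [LinearMap.lTensor_comp, LinearMap.lTensor_comp, LinearMap.comp_assoc, h3,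
      LinearMap.comp_assoc, hφ, hΔ, ← hφ]
    exact congrArg (· ∘ₗ X.coendUnit.lin) (map_lTensor_assoc φ X.coendUnit.lin)

end Coend

end LeftComod

/-! ### Cotensor products with cofree left comodules -/

namespace RightComod

variable {R : Type u} [CommRing R] {D : Type u} [AddCommGroup D] [Module R D] [Coalgebra R D]

/-- The contraction of the middle factor of `M ⊗ D ⊗ W` with the counit. -/
def contract (M D W : Type u) [AddCommGroup M] [Module R M] [AddCommGroup D] [Module R D]
    [Coalgebra R D] [AddCommGroup W] [Module R W] : M ⊗[R] (D ⊗[R] W) →ₗ[R] M ⊗[R] W :=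
  ((TensorProduct.lid R W).toLinearMap ∘ₗ
    (Coalgebra.counit (R := R) (A := D)).rTensor W).lTensor M

/-- This is the counit law of M tensored with W. It makes the map M ⊗ W → M ⊗ D ⊗ W split injective.
-/
theorem contract_coact (M : RightComod R D) (W : Type u) [AddCommGroup W] [Module R W]
    (z : M.carrier ⊗[R] W) : contract M.carrier D W
      (TensorProduct.assoc R M.carrier D W (M.coact.rTensor W z)) = z := by
  induction z with
  | zero => simp
  | add a b ha hb => simp only [map_add, ha, hb]
  | tmul m w =>
    have h : ∀ y : M.carrier ⊗[R] D, contract M.carrier D W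
        (TensorProduct.assoc R M.carrier D W (y ⊗ₜ w)) =
          TensorProduct.rid R _ ((Coalgebra.counit (R := R) (A := D)).lTensor _ y) ⊗ₜ[R] w := by
      intro y
      induction y with
      | zero => simp
      | add a b ha hb => simp only [map_add, TensorProduct.add_tmul, ha, hb]
      | tmul m d => simp [contract, TensorProduct.smul_tmul]
    rw [LinearMap.rTensor_tmul, h, ← LinearMap.comp_apply (LinearMap.lTensor _ _), M.counit_coact]
    simp

theorem coact_rTensor_injective (M : RightComod R D) (W : Type u) [AddCommGroup W] [Module R W] :
    Function.Injective ((TensorProduct.assoc R M.carrier D W).toLinearMap ∘ₗ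
      M.coact.rTensor W) :=
  Function.LeftInverse.injective (contract_coact M W)

/-- The cotensor product of `M` and `D ⊗ W` is `M ⊗ W`. -/
theorem exact_coact_rTensor (M : RightComod R D) (W : Type u) [AddCommGroup W] [Module R W] :
    Function.Exact ((TensorProduct.assoc R M.carrier D W).toLinearMap ∘ₗ M.coact.rTensor W)
      (cotensorDiff M (LeftComod.tensor (LeftComod.regular R D) W)) := by
  have h1 : ∀ z : M.carrier ⊗[R] (D ⊗[R] W), (contract D D W).lTensor M.carrier
      (TensorProduct.assoc R M.carrier D (D ⊗[R] W) (M.coact.rTensor (D ⊗[R] W) z)) =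
      TensorProduct.assoc R M.carrier D W (M.coact.rTensor W (contract M.carrier D W z)) := by
    intro z
    induction z with
    | zero => simp
    | add a b ha hb => simp only [map_add, ha, hb]
    | tmul m t =>
      simp only [contract, LinearMap.rTensor_tmul, LinearMap.lTensor_tmul]
      generalize M.coact m = y
      induction y <;> simp_all [TensorProduct.add_tmul]
  -- The same contraction works for Δ ⊗ W, with D as a right comodule over itself. Applied to the
  -- last factors it recovers z from (id ⊗ Δ ⊗ id) z.
  have h2 : (contract D D W) ∘ₗ Coact.left (Coalgebra.comul (R := R) (A := D)) W =
      LinearMap.id := LinearMap.ext fun z => contract_coact (regular R D) W z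
  have h3 : ∀ z : M.carrier ⊗[R] (D ⊗[R] W), (contract D D W).lTensor M.carrier
      ((Coact.left (Coalgebra.comul (R := R) (A := D)) W).lTensor M.carrier z) = z := fun z => by
    rw [← LinearMap.lTensor_comp_apply, h2, LinearMap.lTensor_id, LinearMap.id_apply]
  intro z
  refine (sub_eq_zero (a := TensorProduct.assoc R M.carrier D (D ⊗[R] W)
    (M.coact.rTensor (D ⊗[R] W) z)) (b := (Coact.left (Coalgebra.comul (R := R) (A := D))
      W).lTensor M.carrier z)).trans ?_
  constructor
  · intro h
    refine ⟨contract M.carrier D W z, (h1 z).symm.trans ?_⟩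
    rw [h, h3]
  · rintro ⟨y, rfl⟩
    induction y with
    | zero => simp
    | add a b ha hb => simp only [map_add, ha, hb]
    | tmul m w =>
      have hm := LinearMap.congr_fun M.coassoc m
      simp only [LinearMap.comp_apply, LinearEquiv.coe_coe, LinearMap.rTensor_tmul] at hm ⊢
      -- With h5 this reduces the remaining equation to coassociativity of M tensored with w.
      have h4 : ∀ y : M.carrier ⊗[R] D, TensorProduct.assoc R M.carrier D (D ⊗[R] W)
          (M.coact.rTensor (D ⊗[R] W) (TensorProduct.assoc R M.carrier D W (y ⊗ₜ w))) =
          (TensorProduct.assoc R D D W).toLinearMap.lTensor M.carrier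
            (TensorProduct.assoc R M.carrier (D ⊗[R] D) W
              (TensorProduct.assoc R M.carrier D D (M.coact.rTensor D y) ⊗ₜ w)) := by
        intro y
        induction y with
        | zero => simp
        | add a b ha hb => simp only [map_add, TensorProduct.add_tmul, ha, hb]
        | tmul m d =>
          simp only [LinearMap.rTensor_tmul, TensorProduct.assoc_tmul]
          generalize M.coact m = t
          induction t <;> simp_all [TensorProduct.add_tmul]
      have h5 : ∀ y : M.carrier ⊗[R] D,
          (Coact.left (Coalgebra.comul (R := R) (A := D)) W).lTensor M.carrier
            (TensorProduct.assoc R M.carrier D W (y ⊗ₜ w)) =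
          (TensorProduct.assoc R D D W).toLinearMap.lTensor M.carrier
            (TensorProduct.assoc R M.carrier (D ⊗[R] D) W
              ((Coalgebra.comul (R := R) (A := D)).lTensor M.carrier y ⊗ₜ w)) := by
        intro y
        induction y <;> simp_all [TensorProduct.add_tmul]
      rw [h4, h5, hm]

/-- This is M □ D ≅ M, the exactness of `exact_coactHom` read through the associator. -/
theorem exact_coact (M : RightComod R D) :
    Function.Exact M.coact (cotensorDiff M (LeftComod.regular R D)) := by
  intro z
  refine Iff.trans ?_ (M.exact_coactHom z)
  have h : (cobarDiff M).lin z = (TensorProduct.assoc R M.carrier D D).symm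
      (cotensorDiff M (LeftComod.regular R D) z) := by
    refine Eq.trans ?_ (map_sub (TensorProduct.assoc R M.carrier D D).symm _ _).symm
    rw [cobarDiff, sub_lin]
    exact (sub_left_inj.2 (LinearEquiv.symm_apply_apply (TensorProduct.assoc R M.carrier D D)
      (M.coact.rTensor D z))).symm
  exact (LinearEquiv.map_eq_zero_iff _).symm.trans (Iff.of_eq (congrArg (· = 0) h)).symm

end RightComod

/-! ### The left structure of X from the equivalence X □ - -/

namespace Bicomod

open LeftComod

variable {R : Type u} [CommRing R] {C D : Type u} [AddCommGroup C] [Module R C] [Coalgebra R C]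
  [AddCommGroup D] [Module R D] [Coalgebra R D] [Module.Flat R C] (X : Bicomod R C D)

/-- The isomorphism of `X ⊗ W` with `X □ (D ⊗ W)`. -/
noncomputable def tensorIso (W : Type u) [AddCommGroup W] [Module R W] :
    tensor X.left W ≅ X.cotensorLeft (tensor (regular R D) W) :=
  isoOfRangeEq (X.coactRightTensor W) (X.cotensorLeftι (tensor (regular R D) W))
    (X.right.coact_rTensor_injective W) (X.cotensorLeftι_injective _)
    ((LinearMap.exact_iff.1 (X.right.exact_coact_rTensor W)).symm.trans
      (Submodule.range_subtype _).symm)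

theorem tensorIso_comp (W : Type u) [AddCommGroup W] [Module R W] :
    (X.tensorIso W).hom ≫ X.cotensorLeftι (tensor (regular R D) W) = X.coactRightTensor W :=
  isoOfRangeEq_hom_comp _ _ _ _ _

theorem tensorIso_naturality {V W : Type u} [AddCommGroup V] [Module R V] [AddCommGroup W]
    [Module R W] (g : V →ₗ[R] W) :
    tensorMapRight X.left g ≫ (X.tensorIso W).hom = (X.tensorIso V).hom ≫
      (show X.cotensorLeft (tensor (regular R D) V) ⟶ X.cotensorLeft (tensor (regular R D) W) from
        X.cotensorLeftFunctor.map (tensorMapRight (regular R D) g)) := by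
  have := mono_of_injective _ (X.cotensorLeftι_injective (tensor (regular R D) W))
  rw [← cancel_mono (X.cotensorLeftι (tensor (regular R D) W)), Category.assoc, Category.assoc,
    tensorIso_comp]
  refine Eq.trans ?_ (congrArg (_ ≫ ·) (X.cotensorLeftFunctor_map_comp
    (tensorMapRight (regular R D) g))).symm
  refine Eq.trans ?_ (Category.assoc _ _ _)
  refine Eq.trans ?_ (congrArg (· ≫ _) (X.tensorIso_comp V)).symm
  refine hom_ext (TensorProduct.ext' fun x v => ?_)
  change TensorProduct.assoc R _ D W (X.right.coact x ⊗ₜ g v) =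
    (g.lTensor D).lTensor _ (TensorProduct.assoc R _ D V (X.right.coact x ⊗ₜ v))
  generalize X.right.coact x = y
  induction y <;> simp_all [TensorProduct.add_tmul]

/-- The functors `X ⊗ -` and `X □ (D ⊗ -)` agree. -/
noncomputable def tensorFunctorIso :
    X.left.tensorFunctor ≅ (regular R D).tensorFunctor ⋙ X.cotensorLeftFunctor :=
  NatIso.ofComponents (fun W => X.tensorIso W) fun g => X.tensorIso_naturality g.hom

/-- The isomorphism of `X` with `X □ D`. -/
noncomputable def leftIso : X.left ≅ X.cotensorLeft (regular R D) :=
  isoOfRangeEq X.coactRight (X.cotensorLeftι (regular R D))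
    X.right.coact_injective (X.cotensorLeftι_injective _)
    ((LinearMap.exact_iff.1 X.right.exact_coact).symm.trans (Submodule.range_subtype _).symm)

theorem leftIso_comp :
    X.leftIso.hom ≫ X.cotensorLeftι (regular R D) = X.coactRight :=
  isoOfRangeEq_hom_comp _ _ _ _ _

/-- Under X ≅ X □ D and X ⊗ W ≅ X □ (D ⊗ W), the map (id ⊗ g) ϱ is the image under X □ - of the
colinear map D ⟶ D ⊗ W that corresponds to g. Inside X ⊗ D ⊗ W this is coassociativity of ϱ. -/
theorem leftIso_cofree (W : Type u) [AddCommGroup W] [Module R W] (g : D →ₗ[R] W) :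
    X.coactRight ≫ tensorMapRight X.left g = X.leftIso.hom ≫
      (show X.cotensorLeft (regular R D) ⟶ X.cotensorLeft (tensor (regular R D) W) from
        X.cotensorLeftFunctor.map (cofreeEquiv (regular R D) W g)) ≫ (X.tensorIso W).inv := by
  have := mono_of_injective _ (X.cotensorLeftι_injective (tensor (regular R D) W))
  rw [← Category.assoc, Iso.eq_comp_inv,
    ← cancel_mono (X.cotensorLeftι (tensor (regular R D) W)), Category.assoc, Category.assoc,
    Category.assoc, tensorIso_comp]
  refine Eq.trans ?_ (congrArg (_ ≫ ·) (X.cotensorLeftFunctor_map_comp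
    (cofreeEquiv (regular R D) W g))).symm
  refine Eq.trans ?_ (Category.assoc _ _ _)
  refine Eq.trans ?_ (congrArg (· ≫ _) X.leftIso_comp).symm
  refine hom_ext (LinearMap.ext fun x => ?_)
  have hx := LinearMap.congr_fun X.right.coassoc x
  change TensorProduct.assoc R _ D W (X.right.coact.rTensor W (g.lTensor _ (X.right.coact x))) =
    (g.lTensor D ∘ₗ Coalgebra.comul).lTensor _ (X.right.coact x)
  rw [LinearMap.lTensor_comp_apply]
  refine Eq.trans ?_ (congrArg _ hx)
  change _ = (g.lTensor D).lTensor _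
    (TensorProduct.assoc R _ D D (X.right.coact.rTensor D (X.right.coact x)))
  generalize X.right.coact x = y
  induction y with
  | zero => simp
  | add a b ha hb => simp only [map_add, ha, hb]
  | tmul m d =>
    simp only [LinearMap.rTensor_tmul, LinearMap.lTensor_tmul]
    generalize X.right.coact m = t
    induction t <;> simp_all [TensorProduct.add_tmul]

variable [X.cotensorLeftFunctor.IsEquivalence]

/-- The left adjoint of `X ⊗ -`. -/
noncomputable def leftAdj : X.cotensorLeftFunctor.inv ⋙ forgetful R D ⊣ X.left.tensorFunctor :=
  (X.cotensorLeftFunctor.asEquivalence.symm.toAdjunction.comp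
    (forgetfulAdj R D)).ofNatIsoRight X.tensorFunctorIso.symm

theorem left_quasiFinite : X.left.QuasiFinite :=
  X.leftAdj.isRightAdjoint

/-- The left adjoint of X ⊗ - is the inverse of X □ - followed by the forgetful functor; flatness of
D makes the latter preserve monomorphisms. -/
theorem left_injector [Module.Flat R D] : X.left.Injector :=
  fun W _ => Injective.injective_of_adjoint X.leftAdj W

/-- The module functor X □ - is the equivalence `cotensorLeftFunctor` with the left C-coaction
forgotten; the equivalence preserves exactness and is faithful. -/
theorem right_faithfullyCoflat [Module.Flat R D] : X.right.FaithfullyCoflat := by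
  refine ⟨fun N₁ N₂ N₃ f g hfg => exact_map X.cotensorLeftFunctor hfg, ⟨fun {M N} f g h => ?_⟩⟩
  exact X.cotensorLeftFunctor.map_injective (hom_ext (congrArg ModuleCat.Hom.hom h))

/-- Full faithfulness of X □ - reduces maps X ⟶ X ⊗ W to maps D ⟶ D ⊗ W, and cofreeness reduces
these to linear maps D → W. -/
theorem coactRight_universal (W : Type u) [AddCommGroup W] [Module R W] :
    Function.Bijective fun g : D →ₗ[R] W => X.coactRight ≫ tensorMapRight X.left g := by
  simp only [leftIso_cofree]
  have h1 : Function.Bijective fun f : X.cotensorLeft (regular R D) ⟶ X.cotensorLeft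
      (tensor (regular R D) W) => X.leftIso.hom ≫ f ≫ (X.tensorIso W).inv :=
    (((X.tensorIso W).symm.homToEquiv).trans X.leftIso.symm.homFromEquiv).bijective
  exact h1.comp ((Functor.FullyFaithful.ofFullyFaithful X.cotensorLeftFunctor).map_bijective _ _
    |>.comp (cofreeEquiv (regular R D) W).bijective)

/-- The universal map is the right coaction of X, so the two conditions on it are the comodule
axioms. -/
theorem coend_left [X.left.QuasiFinite] : Nonempty (X.left.Coend ≃ₗc[R] D) :=
  coend_equiv_of_universal _ X.coactRight (fun W => X.coactRight_universal W)
    (hom_ext X.right.coassoc.symm) (hom_ext X.right.counit_coact)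

end Bicomod

/-! ### Assembly for F(C) and for G(D) -/

theorem imageBicomod_properties {R : Type u} [CommRing R]
    {C : Type u} [AddCommGroup C] [Module R C] [Coalgebra R C] [Module.Flat R C]
    {D : Type u} [AddCommGroup D] [Module R D] [Coalgebra R D] [Module.Flat R D]
    (E : RightComod R C ≌ RightComod R D) [E.functor.Additive] [E.functor.Linear R] :
    ((imageBicomod E).right.QuasiFinite ∧
      (imageBicomod E).right.FaithfullyCoflat ∧
      (imageBicomod E).right.Injector) ∧
    ((imageBicomod E).left.QuasiFinite ∧
      (imageBicomod E).left.FaithfullyCoflat ∧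
      (imageBicomod E).left.Injector) ∧
    (∃ _ : (imageBicomod E).right.QuasiFinite,
      Nonempty ((imageBicomod E).right.Coend ≃ₗc[R] C)) ∧
    (∃ _ : (imageBicomod E).left.QuasiFinite,
      Nonempty ((imageBicomod E).left.Coend ≃ₗc[R] D)) := by
  -- Flatness of G(D) and of F(C) is needed for the two composites of X □ - and Y □ - respectively;
  -- each purity statement comes from one direction of the equivalence.
  have : Module.Flat R (imageBicomod E).right.carrier := RightComod.image_flat E
  have : Module.Flat R (imageBicomod E.symm).right.carrier := RightComod.image_flat E.symm
  have hb := isPureCotensor_image E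
  have hb' : IsPureCotensor (imageBicomod E.symm) (imageBicomod E) _ :=
    isPureCotensor_image E.symm
  have : (imageBicomod E).cotensorLeftFunctor.IsEquivalence :=
    inferInstanceAs (hb.equivalence hb').functor.IsEquivalence
  have hr : (imageBicomod E).right.QuasiFinite := RightComod.quasiFinite_image E
  have hl : (imageBicomod E).left.QuasiFinite := (imageBicomod E).left_quasiFinite
  exact ⟨⟨hr, (imageBicomod E).right_faithfullyCoflat, RightComod.injector_image E⟩,
    ⟨hl, RightComod.image_left_coflat E, (imageBicomod E).left_injector⟩,
    ⟨hr, have : (E.functor.obj (RightComod.regular R C)).QuasiFinite := hr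
      RightComod.coend_image E⟩, ⟨hl, (imageBicomod E).coend_left⟩⟩

theorem mainTheorem8 {R : Type u} [CommRing R]
    {C : Type u} [AddCommGroup C] [Module R C] [Coalgebra R C] [Module.Flat R C]
    {D : Type u} [AddCommGroup D] [Module R D] [Coalgebra R D] [Module.Flat R D]
    (E : RightComod R C ≌ RightComod R D) [E.functor.Additive] [E.functor.Linear R] :
    -- `F(C)` as a right `D`-comodule
    ((imageBicomod E).right.QuasiFinite ∧
      (imageBicomod E).right.FaithfullyCoflat ∧
      (imageBicomod E).right.Injector) ∧
    -- `F(C)` as a left `C`-comodule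
    ((imageBicomod E).left.QuasiFinite ∧
      (imageBicomod E).left.FaithfullyCoflat ∧
      (imageBicomod E).left.Injector) ∧
    -- `e_D(F(C)) ≅ C` and `e_C(F(C)) ≅ D` as coalgebras
    (∃ _ : (imageBicomod E).right.QuasiFinite,
      Nonempty ((imageBicomod E).right.Coend ≃ₗc[R] C)) ∧
    (∃ _ : (imageBicomod E).left.QuasiFinite,
      Nonempty ((imageBicomod E).left.Coend ≃ₗc[R] D)) ∧
    -- `G(D)` as a right `C`-comodule
    ((imageBicomod E.symm).right.QuasiFinite ∧
      (imageBicomod E.symm).right.FaithfullyCoflat ∧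
      (imageBicomod E.symm).right.Injector) ∧
    -- `G(D)` as a left `D`-comodule
    ((imageBicomod E.symm).left.QuasiFinite ∧
      (imageBicomod E.symm).left.FaithfullyCoflat ∧
      (imageBicomod E.symm).left.Injector) ∧
    -- `e_C(G(D)) ≅ D` and `e_D(G(D)) ≅ C` as coalgebras
    (∃ _ : (imageBicomod E.symm).right.QuasiFinite,
      Nonempty ((imageBicomod E.symm).right.Coend ≃ₗc[R] D)) ∧
    (∃ _ : (imageBicomod E.symm).left.QuasiFinite,
      Nonempty ((imageBicomod E.symm).left.Coend ≃ₗc[R] C)) := by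
  obtain ⟨h1, h2, h3, h4⟩ := imageBicomod_properties E
  -- G(D) is the image bicomodule of the inverse equivalence, with the roles of C and D exchanged.
  obtain ⟨h5, h6, h7, h8⟩ := imageBicomod_properties E.symm
  exact ⟨h1, h2, h3, h4, h5, h6, h7, h8⟩
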